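/- **Theorem 3.1.** There is a deterministic algorithm which, given a prime $p$, positive integers $n,t,s$ and matrices $A_1,\dots,A_t\in\mathrm{GL}(n,\mathbb F_p)$, decides whether the matrix algebra $\mathbb F_p[A_1,\dots,A_t]$ (the $\mathbb F_p$-subalgebra of the $n\times n$ matrices over $\mathbb F_p$ generated by $A_1,\dots,A_t$) is a finite field with extension degree $s$ over $\mathbb F_p$, and which performs at most $\mathcal O(t\,n^6\log p)$ elementary operations in $\mathbb F_p$; no factoring oracle is used. Here the algorithm is a single program, and the implied constant a single constant, independent of $p,n,t,s$ and of the matrices. The program runs on a deterministic random access machine with cells for elements of $\mathbb F_p$ and cells for natural numbers. The elementary operations in $\mathbb F_p$ are addition, subtraction, multiplication, inversion and equality testing. The natural numbers, which serve for indices and control, may be added, subtracted (truncated at $0$), halved (rounding down) and compared; the machine cannot convert between field elements and natural numbers. The bound $\mathcal O(t\,n^6\log p)$ holds for the total number of steps, in which every operation on field elements and on natural numbers, every memory access, assignment and branch counts as one step. -/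

import Mathlib

/-!
A random access machine over a field, presented as a small imperative language.

A program is a fixed finite syntactic object that mentions no field.  The same program is executed
over every prime field `ZMod p`.  Its memory has two sorts of cells.
* Number cells hold natural numbers (loop counters, indices, the characteristic).  Number variables
  are `x₀, x₁, …`, and there are also one-dimensional arrays of numbers.
* Field cells hold elements of the field and form arrays with three indices.

Numbers can be added, subtracted (truncated at `0`), halved (rounding down) and compared.  Field
elements can be added, subtracted, multiplied, inverted and compared for equality.  There is no
conversion between the two sorts, no multiplication of numbers, no random choice and no oracle.

Every arithmetic operation, constant, memory access, comparison, Boolean connective, assignment and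
branch costs one step.
-/
namespace FieldRAM

/-- Contents of the memory, with field elements taken from `K`. -/
@[ext] structure Mem (K : Type) where
  /-- The value of each number variable. -/
  num : ℕ → ℕ
  /-- `narr a i` is the cell `i` of the number array `a`. -/
  narr : ℕ → ℕ → ℕ
  /-- `farr a i j k` is the cell `(i, j, k)` of the field array `a`. -/
  farr : ℕ → ℕ → ℕ → ℕ → K

/-- Expressions for natural numbers. -/
inductive NExp where
  | const (c : ℕ)
  | var (x : ℕ)
  | cell (a : ℕ) (i : NExp)
  | add (e f : NExp)
  | sub (e f : NExp)
  | half (e : NExp)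

/-- Expressions for field elements.  `a` is the name of an array. -/
inductive FExp where
  | zero
  | one
  | cell (a : ℕ) (i j k : NExp)
  | add (e f : FExp)
  | sub (e f : FExp)
  | mul (e f : FExp)
  | inv (e : FExp)

/-- Boolean tests. -/
inductive Cond where
  | numEq (e f : NExp)
  | numLt (e f : NExp)
  | fieldEq (e f : FExp)
  | neg (b : Cond)
  | conj (b c : Cond)

/-- Programs. -/
inductive Prog where
  | skip
  | setNum (x : ℕ) (e : NExp)
  | setNumCell (a : ℕ) (i : NExp) (e : NExp)
  | setField (a : ℕ) (i j k : NExp) (e : FExp)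
  | seq (P Q : Prog)
  | ite (b : Cond) (P Q : Prog)
  | loop (b : Cond) (P : Prog)

/-- Value of a number expression. -/
def NExp.eval {K : Type} (m : Mem K) : NExp → ℕ
  | .const c => c
  | .var x => m.num x
  | .cell a i => m.narr a (i.eval m)
  | .add e f => e.eval m + f.eval m
  | .sub e f => e.eval m - f.eval m
  | .half e => e.eval m / 2

/-- Number of steps used to evaluate a number expression. -/
def NExp.cost : NExp → ℕ
  | .const _ => 1
  | .var _ => 1
  | .cell _ i => i.cost + 1
  | .add e f => e.cost + f.cost + 1
  | .sub e f => e.cost + f.cost + 1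
  | .half e => e.cost + 1

/-- Value of a field expression, with the convention that the inverse of `0` is `0`. -/
def FExp.eval {K : Type} [Field K] (m : Mem K) : FExp → K
  | .zero => 0
  | .one => 1
  | .cell a i j k => m.farr a (i.eval m) (j.eval m) (k.eval m)
  | .add e f => e.eval m + f.eval m
  | .sub e f => e.eval m - f.eval m
  | .mul e f => e.eval m * f.eval m
  | .inv e => (e.eval m)⁻¹

/-- Number of steps used to evaluate a field expression. -/
def FExp.cost : FExp → ℕ
  | .zero => 1
  | .one => 1
  | .cell _ i j k => i.cost + j.cost + k.cost + 1
  | .add e f => e.cost + f.cost + 1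
  | .sub e f => e.cost + f.cost + 1
  | .mul e f => e.cost + f.cost + 1
  | .inv e => e.cost + 1

/-- Truth of a test. -/
def Cond.Holds {K : Type} [Field K] (m : Mem K) : Cond → Prop
  | .numEq e f => e.eval m = f.eval m
  | .numLt e f => e.eval m < f.eval m
  | .fieldEq e f => e.eval m = f.eval m
  | .neg b => ¬ b.Holds m
  | .conj b c => b.Holds m ∧ c.Holds m

/-- Number of steps used to evaluate a test. -/
def Cond.cost : Cond → ℕ
  | .numEq e f => e.cost + f.cost + 1
  | .numLt e f => e.cost + f.cost + 1
  | .fieldEq e f => e.cost + f.cost + 1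
  | .neg b => b.cost + 1
  | .conj b c => b.cost + c.cost + 1

/-- Assign `v` to the number variable `x`. -/
def Mem.setNum {K : Type} (m : Mem K) (x v : ℕ) : Mem K :=
  { m with num := fun y => if y = x then v else m.num y }

/-- Assign `v` to the cell `i` of the number array `a`. -/
def Mem.setNumCell {K : Type} (m : Mem K) (a i v : ℕ) : Mem K :=
  { m with narr := fun b l => if b = a ∧ l = i then v else m.narr b l }

/-- Assign `v` to the cell `(i, j, k)` of the field array `a`. -/
def Mem.setField {K : Type} (m : Mem K) (a i j k : ℕ) (v : K) : Mem K :=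
  { m with farr := fun b x y z =>
      if b = a ∧ x = i ∧ y = j ∧ z = k then v else m.farr b x y z }

/-- `Run P m m' T`: started in the memory `m`, the program `P` halts in the memory `m'` after
exactly `T` steps. -/
inductive Run {K : Type} [Field K] : Prog → Mem K → Mem K → ℕ → Prop where
  | skip (m : Mem K) : Run .skip m m 1
  | setNum (m : Mem K) (x : ℕ) (e : NExp) :
      Run (.setNum x e) m (m.setNum x (e.eval m)) (e.cost + 1)
  | setNumCell (m : Mem K) (a : ℕ) (i e : NExp) :
      Run (.setNumCell a i e) m (m.setNumCell a (i.eval m) (e.eval m)) (i.cost + e.cost + 1)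
  | setField (m : Mem K) (a : ℕ) (i j k : NExp) (e : FExp) :
      Run (.setField a i j k e) m
        (m.setField a (i.eval m) (j.eval m) (k.eval m) (e.eval m))
        (i.cost + j.cost + k.cost + e.cost + 1)
  | seq {P Q : Prog} {m₁ m₂ m₃ : Mem K} {T U : ℕ} (hP : Run P m₁ m₂ T) (hQ : Run Q m₂ m₃ U) :
      Run (.seq P Q) m₁ m₃ (T + U)
  | iteTrue {b : Cond} {P Q : Prog} {m m' : Mem K} {T : ℕ} (hb : b.Holds m) (hP : Run P m m' T) :
      Run (.ite b P Q) m m' (b.cost + 1 + T)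
  | iteFalse {b : Cond} {P Q : Prog} {m m' : Mem K} {T : ℕ} (hb : ¬ b.Holds m)
      (hQ : Run Q m m' T) : Run (.ite b P Q) m m' (b.cost + 1 + T)
  | loopExit {b : Cond} {P : Prog} {m : Mem K} (hb : ¬ b.Holds m) :
      Run (.loop b P) m m (b.cost + 1)
  | loopNext {b : Cond} {P : Prog} {m₁ m₂ m₃ : Mem K} {T U : ℕ} (hb : b.Holds m₁)
      (hP : Run P m₁ m₂ T) (hL : Run (.loop b P) m₂ m₃ U) :
      Run (.loop b P) m₁ m₃ (b.cost + 1 + T + U)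

/-- The machine is deterministic: the initial memory determines the final memory and the number of
steps. -/
theorem Run.deterministic {K : Type} [Field K] {P : Prog} {m m₁ m₂ : Mem K} {T₁ T₂ : ℕ}
    (h₁ : Run P m m₁ T₁) (h₂ : Run P m m₂ T₂) : m₁ = m₂ ∧ T₁ = T₂ := by
  induction h₁ generalizing m₂ T₂ with
  | skip => cases h₂; exact ⟨rfl, rfl⟩
  | setNum => cases h₂; exact ⟨rfl, rfl⟩
  | setNumCell => cases h₂; exact ⟨rfl, rfl⟩
  | setField => cases h₂; exact ⟨rfl, rfl⟩
  | seq _ _ ihP ihQ =>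
    cases h₂ with
    | seq hP hQ =>
      obtain ⟨rfl, rfl⟩ := ihP hP
      obtain ⟨rfl, rfl⟩ := ihQ hQ
      exact ⟨rfl, rfl⟩
  | iteTrue hb _ ih =>
    cases h₂ with
    | iteTrue _ h => obtain ⟨rfl, rfl⟩ := ih h; exact ⟨rfl, rfl⟩
    | iteFalse hb' _ => exact absurd hb hb'
  | iteFalse hb _ ih =>
    cases h₂ with
    | iteTrue hb' _ => exact absurd hb' hb
    | iteFalse _ h => obtain ⟨rfl, rfl⟩ := ih h; exact ⟨rfl, rfl⟩
  | loopExit hb =>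
    cases h₂ with
    | loopExit _ => exact ⟨rfl, rfl⟩
    | loopNext hb' _ _ => exact absurd hb' hb
  | loopNext hb _ _ ihP ihL =>
    cases h₂ with
    | loopExit hb' => exact absurd hb hb'
    | loopNext _ hP hL =>
      obtain ⟨rfl, rfl⟩ := ihP hP
      obtain ⟨rfl, rfl⟩ := ihL hL
      exact ⟨rfl, rfl⟩

/-- The initial memory on the input `A₁, …, A_t ∈ GL(n, 𝔽_p)` and `s`: the number variables
`x₀, x₁, x₂, x₃` hold `p, n, t, s`, the cell `(l, i, j)` of the field array `0` holds the entry
`(i, j)` of the matrix with index `l` (all indices start from `0`), and every other cell holds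
`0`. -/
def input (p n t s : ℕ) [Fact p.Prime] (A : Fin t → GL (Fin n) (ZMod p)) : Mem (ZMod p) where
  num x := if x = 0 then p else if x = 1 then n else if x = 2 then t else if x = 3 then s else 0
  narr _ _ := 0
  farr a l i j :=
    if h : a = 0 ∧ l < t ∧ i < n ∧ j < n then
      (A ⟨l, h.2.1⟩ : Matrix (Fin n) (Fin n) (ZMod p)) ⟨i, h.2.2.1⟩ ⟨j, h.2.2.2⟩
    else 0

/-- The answer of a halted machine is the content of the variable `x₀`: `1` for yes, `0` for no. -/
def Mem.answer {K : Type} (m : Mem K) : ℕ := m.num 0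

end FieldRAM

/-- The matrix algebra `𝔽_p[A₁, …, A_t]` generated by `A₁, …, A_t ∈ GL(n, 𝔽_p)`. -/
def matrixAlgebra {p n t : ℕ} (A : Fin t → GL (Fin n) (ZMod p)) :
    Subalgebra (ZMod p) (Matrix (Fin n) (Fin n) (ZMod p)) :=
  Algebra.adjoin (ZMod p) (Set.range fun l => (A l : Matrix (Fin n) (Fin n) (ZMod p)))

/-- `𝔽_p[A₁, …, A_t]` is a field whose degree over `𝔽_p` is `s`. -/
def IsFieldOfDegree {p n t : ℕ} (A : Fin t → GL (Fin n) (ZMod p)) (s : ℕ) : Prop :=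
  IsField (matrixAlgebra A) ∧ Module.finrank (ZMod p) (matrixAlgebra A) = s

/-!
The algorithm decides whether `R = 𝔽_p[A₁, …, A_t]` is a field of degree `s` by linear algebra.

*The criterion.*  `R` is a field if and only if it is commutative, the Frobenius map `φ : x ↦ x ^ p`
(which is then linear) is injective on `R`, and `φ - id` has corank `1`, so that only the multiples
of `1` are fixed by `φ` (`isField_iff_finrank_frobenius`).  In a field the fixed points of `φ` are
roots of `X ^ p - X`, and `𝔽_p` provides all of them.  Conversely, if `φ` is injective then some
iterate of `φ` is the identity on the finite set `R`, so for `a ≠ 0` a power `a ^ (q - 1)` with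
`a ^ q = a` is a nonzero idempotent.  It is fixed by `φ`, hence a nonzero scalar, and `a` is a unit.

*The algorithm.*  All three conditions, and the degree, are statements on dimensions of spans of
`n × n` matrices.  A single subroutine `insertP` maintains a basis in echelon form: it reduces a
matrix at the pivots found so far, and appends it if something is left.  By linear independence such
a basis has at most `n ^ 2` vectors, so that an insertion takes `O(n ^ 4)` steps.
* `basisP` starts with `A₁` and inserts `A_l * E` for all basis vectors `E`, including those that are
  appended on the way.  The final span is stable under left multiplication by the generators, and it
  contains `1`, a power of the invertible matrix `A₁`; so it is `R` (`adjoin_le_of_mul_mem`).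
  Meanwhile the commutators `A_l * E - E * A_l` are inserted into a second basis, which stays empty
  if and only if `R` is commutative.  There are at most `t * n ^ 2` insertions, which is the source
  of the bound `t * n ^ 6`.
* `frobeniusP` computes `E ^ p` for every basis vector by repeated squaring, in `O(n ^ 3 log p)`
  steps, and inserts `E ^ p` and `E ^ p - E` into two further bases.

*The verification.*  `Prog.Ends` is total correctness with a bound on the number of steps.  What a
program leaves unchanged is read off from its syntax (`Run.frame`), so that the specifications of
the subroutines describe only what they compute.

The number variables from `x₄` on are used as follows: `x₄, x₅` for row and column indices, `x₆` for
the summation index of matrix products, `x₇` for the loop over the pivots, `x₈, x₉, x₁₀` for the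
result of a pivot search, `x₁₁` for the index of a basis vector, `x₁₂` for the index of a generator,
`x₁₃` for an exponent.  The variable `x₁₄` keeps its initial value `0` and serves as the slot of the
matrices in the field arrays `1, 2, 3, 4`; the array `5` holds a single scalar.
-/

/-! ### Rules for total correctness with a time bound -/

namespace FieldRAM

/-- The number variables that `P` may assign. -/
@[simp] def Prog.numTargets : Prog → List ℕ
  | .setNum x _ => [x]
  | .seq P Q => P.numTargets ++ Q.numTargets
  | .ite _ P Q => P.numTargets ++ Q.numTargets
  | .loop _ P => P.numTargets
  | _ => []

/-- The number arrays that `P` may write to. -/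
@[simp] def Prog.narrTargets : Prog → List ℕ
  | .setNumCell a _ _ => [a]
  | .seq P Q => P.narrTargets ++ Q.narrTargets
  | .ite _ P Q => P.narrTargets ++ Q.narrTargets
  | .loop _ P => P.narrTargets
  | _ => []

/-- The field arrays that `P` may write to. -/
@[simp] def Prog.farrTargets : Prog → List ℕ
  | .setField a _ _ _ _ => [a]
  | .seq P Q => P.farrTargets ++ Q.farrTargets
  | .ite _ P Q => P.farrTargets ++ Q.farrTargets
  | .loop _ P => P.farrTargets
  | _ => []

/-- `m'` differs from `m` at most in the variables and arrays that are syntactic targets of `P`. -/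
structure Frame {K : Type} (P : Prog) (m m' : Mem K) : Prop where
  num : ∀ x, x ∉ P.numTargets → m'.num x = m.num x
  narr : ∀ a, a ∉ P.narrTargets → m'.narr a = m.narr a
  farr : ∀ a, a ∉ P.farrTargets → m'.farr a = m.farr a

theorem Frame.refl {K : Type} (P : Prog) (m : Mem K) : Frame P m m :=
  ⟨fun _ _ => rfl, fun _ _ => rfl, fun _ _ => rfl⟩

theorem Frame.trans {K : Type} {P : Prog} {m₁ m₂ m₃ : Mem K} (h : Frame P m₁ m₂)
    (h' : Frame P m₂ m₃) : Frame P m₁ m₃ :=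
  ⟨fun x hx => (h'.num x hx).trans (h.num x hx), fun x hx => (h'.narr x hx).trans (h.narr x hx),
    fun x hx => (h'.farr x hx).trans (h.farr x hx)⟩

theorem Frame.mono {K : Type} {P Q : Prog} {m m' : Mem K} (h : Frame P m m')
    (h₁ : P.numTargets ⊆ Q.numTargets) (h₂ : P.narrTargets ⊆ Q.narrTargets)
    (h₃ : P.farrTargets ⊆ Q.farrTargets) : Frame Q m m' :=
  ⟨fun x hx => h.num x fun h' => hx (h₁ h'), fun x hx => h.narr x fun h' => hx (h₂ h'),
    fun x hx => h.farr x fun h' => hx (h₃ h')⟩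

theorem Run.frame {K : Type} [Field K] {P : Prog} {m m' : Mem K} {T : ℕ} (h : Run P m m' T) :
    Frame P m m' := by
  induction h with
  | skip => exact Frame.refl _ _
  | setNum m x e =>
    refine ⟨fun y hy => ?_, fun _ _ => rfl, fun _ _ => rfl⟩
    simp only [Prog.numTargets, List.mem_singleton] at hy
    simp [Mem.setNum, hy]
  | setNumCell m a i e =>
    refine ⟨fun _ _ => rfl, fun b hb => ?_, fun _ _ => rfl⟩
    simp only [Prog.narrTargets, List.mem_singleton] at hb
    simp [Mem.setNumCell, hb]
  | setField m a i j k e =>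
    refine ⟨fun _ _ => rfl, fun _ _ => rfl, fun b hb => ?_⟩
    simp only [Prog.farrTargets, List.mem_singleton] at hb
    simp [Mem.setField, hb]
  | seq _ _ ihP ihQ =>
    exact (ihP.mono (by simp) (by simp) (by simp)).trans (ihQ.mono (by simp) (by simp) (by simp))
  | iteTrue _ _ ih => exact ih.mono (by simp) (by simp) (by simp)
  | iteFalse _ _ ih => exact ih.mono (by simp) (by simp) (by simp)
  | loopExit => exact Frame.refl _ _
  | loopNext _ _ _ ihP ihL => exact (ihP.mono (by simp) (by simp) (by simp)).trans ihL

/-- Total correctness with a time bound: started in `m`, the program `P` halts after at most `B`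
steps in a memory that satisfies `Q`. -/
def Prog.Ends {K : Type} [Field K] (P : Prog) (m : Mem K) (B : ℕ) (Q : Mem K → Prop) : Prop :=
  ∃ m' T, Run P m m' T ∧ T ≤ B ∧ Q m'

section Rules

variable {K : Type} [Field K] {P P' : Prog} {m : Mem K} {B B' : ℕ} {Q Q' : Mem K → Prop}

/-- The rule of consequence; the new postcondition may use that only targets of `P` change. -/
theorem Prog.Ends.imp (h : P.Ends m B Q) (hB : B ≤ B')
    (hQ : ∀ m', Frame P m m' → Q m' → Q' m') : P.Ends m B' Q' := by
  obtain ⟨m', T, hr, hT, hq⟩ := h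
  exact ⟨m', T, hr, hT.trans hB, hQ m' hr.frame hq⟩

theorem Prog.Ends.mono (h : P.Ends m B Q) (hB : B ≤ B') : P.Ends m B' Q :=
  h.imp hB fun _ _ h => h

theorem ends_skip (h : Q m) : Prog.skip.Ends m 1 Q := ⟨m, 1, .skip m, le_rfl, h⟩

theorem ends_setNum {x : ℕ} {e : NExp} (h : Q (m.setNum x (e.eval m))) :
    (Prog.setNum x e).Ends m (e.cost + 1) Q := ⟨_, _, .setNum m x e, le_rfl, h⟩

theorem ends_setField {a : ℕ} {i j k : NExp} {e : FExp}
    (h : Q (m.setField a (i.eval m) (j.eval m) (k.eval m) (e.eval m))) :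
    (Prog.setField a i j k e).Ends m (i.cost + j.cost + k.cost + e.cost + 1) Q :=
  ⟨_, _, .setField m a i j k e, le_rfl, h⟩

theorem Prog.Ends.seq (h : P.Ends m B Q)
    (h' : ∀ m', Frame P m m' → Q m' → P'.Ends m' B' Q') :
    (Prog.seq P P').Ends m (B + B') Q' := by
  obtain ⟨m₁, T, hr, hT, hq⟩ := h
  obtain ⟨m₂, U, hr', hU, hq'⟩ := h' m₁ hr.frame hq
  exact ⟨m₂, T + U, hr.seq hr', by omega, hq'⟩

theorem ends_ite {b : Cond} (h : b.Holds m → P.Ends m B Q) (h' : ¬ b.Holds m → P'.Ends m B Q) :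
    (Prog.ite b P P').Ends m (b.cost + 1 + B) Q := by
  by_cases hb : b.Holds m
  · obtain ⟨m', T, hr, hT, hq⟩ := h hb
    exact ⟨m', _, .iteTrue hb hr, by omega, hq⟩
  · obtain ⟨m', T, hr, hT, hq⟩ := h' hb
    exact ⟨m', _, .iteFalse hb hr, by omega, hq⟩

/-- The loop rule.  `I k` is the invariant after `k` rounds, and it limits their number to `N`. -/
theorem ends_loop {b : Cond} {N : ℕ} (I : ℕ → Mem K → Prop)
    (step : ∀ k m', Frame P m m' → I k m' → b.Holds m' → k < N ∧ P.Ends m' B (I (k + 1)))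
    (h : I 0 m) :
    (Prog.loop b P).Ends m (N * (B + b.cost + 1) + b.cost + 1)
      (fun m' => ¬ b.Holds m' ∧ ∃ k, I k m') := by
  have key : ∀ r k m', k + r = N → Frame P m m' → I k m' →
      (Prog.loop b P).Ends m' (r * (B + b.cost + 1) + b.cost + 1)
        (fun m' => ¬ b.Holds m' ∧ ∃ k, I k m') := by
    intro r
    induction r with
    | zero =>
      intro k m' hk hf hI
      by_cases hb : b.Holds m'
      · have := (step k m' hf hI hb).1
        omega
      · exact ⟨m', _, .loopExit hb, by omega, hb, k, hI⟩
    | succ r ih =>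
      intro k m' hk hf hI
      by_cases hb : b.Holds m'
      · obtain ⟨m₁, T, hr, hT, hq⟩ := (step k m' hf hI hb).2
        obtain ⟨m₂, U, hr', hU, hq'⟩ := ih (k + 1) m₁ (by omega) (hf.trans hr.frame) hq
        refine ⟨m₂, _, .loopNext hb hr hr', ?_, hq'⟩
        rw [Nat.succ_mul]
        omega
      · exact ⟨m', _, .loopExit hb, by omega, hb, k, hI⟩
  exact key N 0 m (by omega) (Frame.refl _ _) h

end Rules

/-- The loop `for x = 0, …, y - 1 do P`, for number variables `x` and `y`. -/
@[simp] def forP (x y : ℕ) (P : Prog) : Prog :=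
  .seq (.setNum x (.const 0))
    (.loop (.numLt (.var x) (.var y)) (.seq P (.setNum x (.add (.var x) (.const 1)))))

/-- The rule for a bounded loop.  The invariant must not depend on the loop variable. -/
theorem ends_forP {K : Type} [Field K] {P : Prog} {m : Mem K} {B x y N : ℕ}
    (I : ℕ → Mem K → Prop) (hN : m.num y = N) (hxy : y ≠ x) (hx : x ∉ P.numTargets)
    (hy : y ∉ P.numTargets) (hI : ∀ k m' v, I k m' → I k (m'.setNum x v)) (h : I 0 m)
    (step : ∀ k m', k < N → m'.num x = k → Frame (forP x y P) m m' → I k m' →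
      P.Ends m' B (I (k + 1))) :
    (forP x y P).Ends m (N * (B + 8) + 6) (I N) := by
  have h₀ : (Prog.setNum x (.const 0)).Ends m 2
      (fun m' => m'.num x = 0 ∧ m'.num y = N ∧ I 0 m') :=
    ends_setNum ⟨by simp [Mem.setNum, NExp.eval], by simpa [Mem.setNum, hxy] using hN, hI _ _ _ h⟩
  refine (h₀.seq (B' := N * (B + 8) + 4) (Q' := I N) fun m₁ hf₁ ⟨hx₁, hy₁, hI₁⟩ => ?_).mono
    (by omega)
  refine (ends_loop (N := N) (B := B + 4)
    (fun k m' => m'.num x = k ∧ k ≤ N ∧ I k m') ?_ ⟨hx₁, by omega, hI₁⟩).imp ?_ ?_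
  · rintro k m₂ hf₂ ⟨hk, hkN, hIk⟩ hb
    have hf₂y : m₂.num y = N := by
      rw [hf₂.num y (by simp [hy, hxy]), hy₁]
    have hlt : k < N := by simpa [Cond.Holds, NExp.eval, hk, hf₂y] using hb
    refine ⟨hlt, ((step k m₂ hlt hk ?_ hIk).seq (Q' := _) (B' := 4)
      fun m₃ hf₃ hI₃ => ?_)⟩
    · exact (hf₁.mono (by simp) (by simp) (by simp)).trans
        (hf₂.mono (by simp) (by simp) (by simp))
    · have hx₃ : m₃.num x = k := by rw [hf₃.num x hx, hk]
      exact (ends_setNum ⟨by simp [Mem.setNum, NExp.eval, hx₃], by omega,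
        hI _ _ _ hI₃⟩).mono (by simp [NExp.cost])
  · simp [Cond.cost, NExp.cost]
  · rintro m₂ hf₂ ⟨hb, k, hk, hkN, hIk⟩
    have hf₂y : m₂.num y = N := by
      rw [hf₂.num y (by simp [hy, hxy]), hy₁]
    have : ¬ k < N := by simpa [Cond.Holds, NExp.eval, hk, hf₂y] using hb
    obtain rfl : k = N := by omega
    exact hIk

/-! ### Matrix arithmetic -/

/-- The leading `n × n` block of a doubly indexed family, as a matrix. -/
def block {K : Type} (n : ℕ) (f : ℕ → ℕ → K) : Matrix (Fin n) (Fin n) K :=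
  Matrix.of fun i j => f i j

theorem block_eq_iff {K : Type} {n : ℕ} {f g : ℕ → ℕ → K} :
    block n f = block n g ↔ ∀ i < n, ∀ j < n, f i j = g i j := by
  refine ⟨fun h i hi j hj => congrFun (congrFun h ⟨i, hi⟩) ⟨j, hj⟩, fun h => ?_⟩
  ext i j
  exact h i i.2 j j.2

/-- The matrix stored in the slot `l` of the field array `a`. -/
def Mem.mat {K : Type} (n : ℕ) (m : Mem K) (a l : ℕ) : Matrix (Fin n) (Fin n) K :=
  block n (m.farr a l)

/-- The expression for the entry with indices `x₄, x₅` of the matrix in the slot `x_y` of the field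
array `a`. -/
@[simp] def entry (a y : ℕ) : FExp := .cell a (.var y) (.var 4) (.var 5)

/-- The program that fills the matrix in the slot `x_y` of the field array `c`: the entry `(i, j)`
becomes the value of `e` when `x₄ = i` and `x₅ = j`. -/
def fillP (c y : ℕ) (e : FExp) : Prog :=
  forP 4 1 (forP 5 1 (.setField c (.var y) (.var 4) (.var 5) e))

@[simp] theorem numTargets_fillP (c y : ℕ) (e : FExp) : (fillP c y e).numTargets = [4, 5, 5, 4] :=
  rfl
@[simp] theorem narrTargets_fillP (c y : ℕ) (e : FExp) : (fillP c y e).narrTargets = [] := rfl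
@[simp] theorem farrTargets_fillP (c y : ℕ) (e : FExp) : (fillP c y e).farrTargets = [c] := rfl

/-- A bound for the running time of a loop of `n` rounds that take `C * n ^ a` steps each. -/
theorem for_bound {n C : ℕ} (a : ℕ) (hn : 0 < n) :
    n * (C * n ^ a + 8) + 6 ≤ (C + 14) * n ^ (a + 1) := by
  have h1 : n ≤ n ^ (a + 1) := Nat.le_self_pow (by omega) n
  rw [mul_add, add_mul, pow_succ] at *
  nlinarith

section Fill

variable {K : Type} [Field K] {n : ℕ}

/-- The expression `e` may read the cell that is being overwritten, but no other cell of the same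
matrix. -/
theorem ends_fillP {m : Mem K} {c y : ℕ} {e : FExp} (F : ℕ → ℕ → K) (hn : 0 < n)
    (h1 : m.num 1 = n) (h4 : y ≠ 4) (h5 : y ≠ 5)
    (hF : ∀ i j m', i < n → j < n → m'.num 4 = i → m'.num 5 = j →
      (∀ x, x ≠ 4 → x ≠ 5 → m'.num x = m.num x) → m'.narr = m.narr →
      (∀ a l, a ≠ c ∨ l ≠ m.num y → m'.farr a l = m.farr a l) →
      m'.farr c (m.num y) i j = m.farr c (m.num y) i j → e.eval m' = F i j) :
    (fillP c y e).Ends m ((e.cost + 32) * n ^ 2) fun m' =>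
      m'.narr = m.narr ∧ m'.mat n c (m.num y) = block n F ∧
        ∀ a l, a ≠ c ∨ l ≠ m.num y → m'.farr a l = m.farr a l := by
  -- The memory when the rows before `i`, and the entries before `j` of the row `i`, are filled.
  let G : ℕ → ℕ → ℕ → ℕ → ℕ → ℕ → K := fun i j a l x z =>
    if a = c ∧ l = m.num y ∧ z < n ∧ (x < i ∨ x = i ∧ z < j) then F x z else m.farr a l x z
  have hG : ∀ {i j i' j'}, (∀ x z, z < n → ((x < i ∨ x = i ∧ z < j) ↔ (x < i' ∨ x = i' ∧ z < j'))) →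
      G i j = G i' j' := by
    intro i j i' j' h
    funext a l x z
    simp only [G]
    congr 1
    simp only [eq_iff_iff]
    constructor
    · rintro ⟨h1, h2, h3, h4⟩
      exact ⟨h1, h2, h3, (h x z h3).1 h4⟩
    · rintro ⟨h1, h2, h3, h4⟩
      exact ⟨h1, h2, h3, (h x z h3).2 h4⟩
  refine (ends_forP (N := n) (B := (e.cost + 18) * n ^ 1)
    (fun i m' => m'.narr = m.narr ∧ m'.farr = G i 0) h1 (by decide) (by simp)
    (by simp) (fun _ _ _ h => h) ⟨rfl, by funext; simp [G]⟩ ?_).imp ?_ ?_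
  · rintro i m₁ hi h₁4 f₁ ⟨h₁a, h₁f⟩
    have h₁1 : m₁.num 1 = n := by rw [f₁.num 1 (by simp), h1]
    refine (ends_forP (N := n) (B := e.cost + 4)
      (fun j m' => m'.narr = m.narr ∧ m'.farr = G i j) h₁1 (by decide) (by simp) (by simp)
      (fun _ _ _ h => h) ⟨h₁a, h₁f⟩ ?_).imp ?_ ?_
    · rintro j m₂ hj h₂5 f₂ ⟨h₂a, h₂f⟩
      have h₂4 : m₂.num 4 = i := by rw [f₂.num 4 (by simp), h₁4]
      have h₂n : ∀ x, x ≠ 4 → x ≠ 5 → m₂.num x = m.num x := by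
        intro x hx hx'
        rw [f₂.num x (by simp [hx']), f₁.num x (by simp [hx, hx'])]
      have hev : e.eval m₂ = F i j := by
        refine hF i j m₂ hi hj h₂4 h₂5 h₂n h₂a ?_ ?_
        · intro a l hal
          funext x z
          rw [h₂f]
          simp only [G]
          rw [if_neg]
          rintro ⟨h, h', _⟩
          simp_all
        · rw [h₂f]
          simp [G]
      refine (ends_setField ⟨h₂a, ?_⟩).mono (by simp [NExp.cost]; omega)
      funext a l x z
      simp only [Mem.setField, NExp.eval, h₂n y h4 h5, h₂4, h₂5, hev, h₂f, G]
      by_cases h : a = c ∧ l = m.num y ∧ x = i ∧ z = j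
      · obtain ⟨rfl, rfl, rfl, rfl⟩ := h
        simp [hj]
      · rw [if_neg h]
        congr 1
        simp only [eq_iff_iff]
        constructor <;> rintro ⟨rfl, rfl, h3, h4⟩ <;> refine ⟨rfl, rfl, h3, ?_⟩ <;>
          simp only [true_and, not_and] at h <;> omega
    · have := for_bound (C := e.cost + 4) 0 hn
      simpa using this
    · rintro m₃ f₃ ⟨h₃a, h₃f⟩
      exact ⟨h₃a, h₃f.trans (hG fun x z hz => by omega)⟩
  · exact for_bound 1 hn
  · rintro m₁ f₁ ⟨ha, hf⟩
    refine ⟨ha, ?_, ?_⟩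
    · rw [Mem.mat, block_eq_iff]
      intro i hi j hj
      rw [hf]
      simp [G, hi, hj]
    · intro a l hal
      funext x z
      rw [hf]
      simp only [G]
      rw [if_neg]
      rintro ⟨h, h', _⟩
      simp_all

/-- The program that copies the matrix in the slot `x_y` of the array `a` to the slot `x₁₄` of the
array `c`. -/
def copyP (a y c : ℕ) : Prog := fillP c 14 (entry a y)

@[simp] theorem numTargets_copyP (a y c : ℕ) : (copyP a y c).numTargets = [4, 5, 5, 4] := rfl
@[simp] theorem narrTargets_copyP (a y c : ℕ) : (copyP a y c).narrTargets = [] := rfl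
@[simp] theorem farrTargets_copyP (a y c : ℕ) : (copyP a y c).farrTargets = [c] := rfl

theorem ends_copyP {m : Mem K} {a y c : ℕ} (hn : 0 < n) (h1 : m.num 1 = n) (hy4 : y ≠ 4)
    (hy5 : y ≠ 5) (hac : a ≠ c) :
    (copyP a y c).Ends m (36 * n ^ 2) fun m' =>
      m'.mat n c (m.num 14) = m.mat n a (m.num y) := by
  refine (ends_fillP (m.farr a (m.num y)) hn h1 (by decide) (by decide) ?_).imp ?_ ?_
  · intro i j m' _ _ h4 h5 hx _ hf _
    simp [FExp.eval, NExp.eval, h4, h5, hx y hy4 hy5, hf a _ (Or.inl hac)]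
  · simp [FExp.cost, NExp.cost]
  · exact fun m' _ h => h.2.1

/-- The program that writes the difference of the matrices in the slots `x_x` of the array `a` and
`x_y` of the array `b` to the slot `x₁₄` of the array `c`. -/
def subP (a x b y c : ℕ) : Prog := fillP c 14 (.sub (entry a x) (entry b y))

@[simp] theorem numTargets_subP (a x b y c : ℕ) : (subP a x b y c).numTargets = [4, 5, 5, 4] := rfl
@[simp] theorem narrTargets_subP (a x b y c : ℕ) : (subP a x b y c).narrTargets = [] := rfl
@[simp] theorem farrTargets_subP (a x b y c : ℕ) : (subP a x b y c).farrTargets = [c] := rfl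

theorem ends_subP {m : Mem K} {a x b y c : ℕ} (hn : 0 < n) (h1 : m.num 1 = n) (hx4 : x ≠ 4)
    (hx5 : x ≠ 5) (hy4 : y ≠ 4) (hy5 : y ≠ 5) (hac : a ≠ c) (hbc : b ≠ c) :
    (subP a x b y c).Ends m (41 * n ^ 2) fun m' =>
      m'.mat n c (m.num 14) = m.mat n a (m.num x) - m.mat n b (m.num y) := by
  refine (ends_fillP (fun i j => m.farr a (m.num x) i j - m.farr b (m.num y) i j) hn h1
    (by decide) (by decide) ?_).imp ?_ ?_
  · intro i j m' _ _ h4 h5 hx _ hf _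
    simp [FExp.eval, NExp.eval, h4, h5, hx x hx4 hx5, hx y hy4 hy5, hf a _ (Or.inl hac),
      hf b _ (Or.inl hbc)]
  · simp [FExp.cost, NExp.cost]
  · exact fun m' _ h => h.2.1

/-- The program that writes the product of the matrices in the slots `x_x` of the array `a` and
`x_y` of the array `b` to the slot `x₁₄` of the array `c`. -/
def mulP (a x b y c : ℕ) : Prog :=
  .seq (fillP c 14 .zero)
    (forP 6 1 (fillP c 14 (.add (entry c 14) (.mul (.cell a (.var x) (.var 4) (.var 6))
      (.cell b (.var y) (.var 6) (.var 5))))))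

@[simp] theorem numTargets_mulP (a x b y c : ℕ) :
    (mulP a x b y c).numTargets = [4, 5, 5, 4, 6, 4, 5, 5, 4, 6] := rfl
@[simp] theorem narrTargets_mulP (a x b y c : ℕ) : (mulP a x b y c).narrTargets = [] := rfl
@[simp] theorem farrTargets_mulP (a x b y c : ℕ) : (mulP a x b y c).farrTargets = [c, c] := rfl

theorem ends_mulP {m : Mem K} {a x b y c : ℕ} (hn : 0 < n) (h1 : m.num 1 = n) (hx4 : x ≠ 4)
    (hx5 : x ≠ 5) (hx6 : x ≠ 6) (hy4 : y ≠ 4) (hy5 : y ≠ 5) (hy6 : y ≠ 6) (hac : a ≠ c)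
    (hbc : b ≠ c) :
    (mulP a x b y c).Ends m (93 * n ^ 3) fun m' =>
      m'.mat n c (m.num 14) = m.mat n a (m.num x) * m.mat n b (m.num y) := by
  have h₀ := (ends_fillP (m := m) (c := c) (y := 14) (e := .zero) (fun _ _ => 0) hn h1 (by decide)
    (by decide) (fun i j m' _ _ _ _ _ _ _ _ => rfl))
  refine (h₀.seq (B' := 60 * n ^ 3)
    (Q' := fun m' => m'.mat n c (m.num 14) = m.mat n a (m.num x) * m.mat n b (m.num y))
    fun m₁ f₁ ⟨_, h₁, _⟩ => ?_).mono ?_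
  · have e₁ : m₁.num 14 = m.num 14 := f₁.num 14 (by simp)
    refine (ends_forP (N := n) (B := 46 * n ^ 2) (fun k m' => m'.mat n c (m.num 14) =
      block n fun i j => ∑ k' ∈ Finset.range k,
        m.farr a (m.num x) i k' * m.farr b (m.num y) k' j) ((f₁.num 1 (by simp)).trans h1)
        (by decide) (by simp) (by simp) (fun _ _ _ h => h) (by simpa using h₁) ?_).imp ?_ ?_
    · rintro k m₂ hk h₂6 f₂ h₂
      have g : ∀ z, z ≠ 4 → z ≠ 5 → z ≠ 6 → m₂.num z = m.num z := fun z h h' h'' => by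
        rw [f₂.num z (by simp [h, h', h'']), f₁.num z (by simp [h, h'])]
      refine (ends_fillP (n := n) (fun i j => ∑ k' ∈ Finset.range (k + 1),
        m.farr a (m.num x) i k' * m.farr b (m.num y) k' j) hn (by rw [g 1] <;> simp [h1])
        (by decide) (by decide) ?_).imp ?_ ?_
      · intro i j m' hi hj h4 h5 hz _ hf hself
        have e14 : m₂.num 14 = m.num 14 := g 14 (by decide) (by decide) (by decide)
        rw [Mem.mat, block_eq_iff] at h₂
        have hab : ∀ u, u ≠ c → m₂.farr u = m.farr u := fun u hu => by
          rw [f₂.farr u (by simp [hu]), f₁.farr u (by simp [hu])]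
        rw [e14] at hself
        simp only [entry, FExp.eval, NExp.eval, h4, h5, hz x hx4 hx5, hz y hy4 hy5,
          hz 14 (by decide) (by decide), hz 6 (by decide) (by decide), e14, hself,
          hf a _ (Or.inl hac), hf b _ (Or.inl hbc), h₂6, h₂ i hi j hj, Finset.sum_range_succ,
          hab a hac, hab b hbc, g x hx4 hx5 hx6, g y hy4 hy5 hy6]
      · simp [FExp.cost, NExp.cost]
      · intro m' _ h
        rw [← g 14 (by decide) (by decide) (by decide)]
        exact h.2.1
    · exact for_bound 2 hn
    · rintro m₂ _ h₂
      rw [h₂]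
      ext i j
      simp [block, Mem.mat, Matrix.mul_apply, Finset.sum_range]
  · have : n ^ 2 ≤ n ^ 3 := Nat.pow_le_pow_right hn (by norm_num)
    simp only [FExp.cost]
    omega

end Fill

/-- The program that writes the power with exponent `x₀` of the matrix in the slot `x_x` of the
array `a` to the slot `x₁₄` of the array `2`, by repeated squaring. -/
def powP (a x : ℕ) : Prog :=
  .seq (copyP a x 1) <| .seq (copyP a x 2) <| .seq (.setNum 13 (.sub (.var 0) (.const 1))) <|
    .loop (.numLt (.const 0) (.var 13)) <|
      .seq (.ite (.numLt (.add (.half (.var 13)) (.half (.var 13))) (.var 13))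
        (.seq (mulP 2 14 1 14 3) (copyP 3 14 2)) .skip) <|
      .seq (mulP 1 14 1 14 3) <| .seq (copyP 3 14 1) (.setNum 13 (.half (.var 13)))

@[simp] theorem numTargets_powP (a x : ℕ) : (powP a x).numTargets =
    [4, 5, 5, 4, 4, 5, 5, 4, 13, 4, 5, 5, 4, 6, 4, 5, 5, 4, 6, 4, 5, 5, 4, 4, 5, 5, 4, 6, 4, 5, 5,
      4, 6, 4, 5, 5, 4, 13] := rfl
@[simp] theorem narrTargets_powP (a x : ℕ) : (powP a x).narrTargets = [] := rfl
@[simp] theorem farrTargets_powP (a x : ℕ) :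
    (powP a x).farrTargets = [1, 2, 3, 3, 2, 3, 3, 1] := rfl

/-- `Y * X ^ e` is invariant under the step of repeated squaring, for the content `e` of `x₁₃`. -/
theorem ends_powP {K : Type} [Field K] {n p : ℕ} {m : Mem K} {a x : ℕ} (hn : 0 < n)
    (h1 : m.num 1 = n) (h0 : m.num 0 = p) (hp : 0 < p) (hx4 : x ≠ 4) (hx5 : x ≠ 5) (ha1 : a ≠ 1)
    (ha2 : a ≠ 2) :
    (powP a x).Ends m (400 * ((Nat.log 2 p + 1) * n ^ 3)) fun m' =>
      m'.mat n 2 (m.num 14) = m.mat n a (m.num x) ^ p := by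
  have n23 : n ^ 2 ≤ n ^ 3 := Nat.pow_le_pow_right hn (by norm_num)
  have n3 : 0 < n ^ 3 := by positivity
  set M := m.mat n a (m.num x) with hM
  have hcopy : ∀ {m' : Mem K} {a' x' c' : ℕ}, m'.num 1 = n → x' ≠ 4 → x' ≠ 5 → a' ≠ c' → _ :=
    fun {m' a' x' c'} h h' h'' h3 => ends_copyP (m := m') (a := a') (y := x') (c := c') hn h h' h'' h3
  refine ((hcopy h1 hx4 hx5 ha1).seq (B' := 36 * n ^ 2 + (4 + ((Nat.log 2 p + 1) * (300 * n ^ 3) + 4)))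
    (Q' := fun m' => m'.mat n 2 (m.num 14) = M ^ p) fun m₁ f₁ h₁ => ?_).mono ?_
  · have e₁ : m₁.num 14 = m.num 14 := f₁.num 14 (by simp)
    refine (hcopy ((f₁.num 1 (by simp)).trans h1) hx4 hx5 ha2).seq fun m₂ f₂ h₂ => ?_
    have e₂ : m₂.num 14 = m.num 14 := (f₂.num 14 (by simp)).trans e₁
    have h₂2 : m₂.mat n 2 (m.num 14) = M := by
      rw [← e₁, h₂, Mem.mat, f₁.farr a (by simp [ha1]), f₁.num x (by simp [hx4, hx5]), hM, Mem.mat]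
    have h₂1 : m₂.mat n 1 (m.num 14) = M := by
      rw [Mem.mat, f₂.farr 1 (by simp)]
      exact h₁
    have h₂0 : m₂.num 0 = p := by rw [f₂.num 0 (by simp), f₁.num 0 (by simp), h0]
    have h₂n : m₂.num 1 = n := by rw [f₂.num 1 (by simp), f₁.num 1 (by simp), h1]
    refine Prog.Ends.seq (Q := fun m' => m'.num 13 = p - 1 ∧ m'.num 14 = m.num 14 ∧ m'.num 1 = n ∧
      m'.mat n 2 (m.num 14) = M ∧ m'.mat n 1 (m.num 14) = M) ?_ ?_
    · exact ends_setNum ⟨by simp [Mem.setNum, NExp.eval, h₂0], by simpa [Mem.setNum] using e₂,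
        by simpa [Mem.setNum] using h₂n, h₂2, h₂1⟩
    rintro m₃ - ⟨h₃e, h₃14, h₃n, h₃2, h₃1⟩
    refine (ends_loop (N := Nat.log 2 p + 1) 
      (B := 93 * n ^ 3 + 36 * n ^ 2 + 8 + 1 + (93 * n ^ 3 + (36 * n ^ 2 + 3))) (fun k m' =>
      m'.num 13 * 2 ^ k < 2 ^ (Nat.log 2 p + 1) ∧ m'.num 14 = m.num 14 ∧ m'.num 1 = n ∧
      m'.mat n 2 (m.num 14) * m'.mat n 1 (m.num 14) ^ (m'.num 13) = M ^ p) ?_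
      ⟨?_, h₃14, h₃n, ?_⟩).imp ?_ ?_
    · rintro k m₄ - ⟨hlt, h₄14, h₄n, h₄⟩ hb
      have hpos : 0 < m₄.num 13 := by simpa [Cond.Holds, NExp.eval] using hb
      refine ⟨?_, ?_⟩
      · rw [← Nat.pow_lt_pow_iff_right (a := 2) (by norm_num)]
        nlinarith [Nat.two_pow_pos k]
      set e := m₄.num 13 with he
      refine Prog.Ends.seq (Q := fun m' => m'.mat n 2 (m.num 14) = m₄.mat n 2 (m.num 14) *
        m₄.mat n 1 (m.num 14) ^ (e % 2)) ?_ ?_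
      · refine (ends_ite (B := 93 * n ^ 3 + 36 * n ^ 2) ?_ ?_).mono
          (by simp only [Cond.cost, NExp.cost]; omega)
        · intro hodd
          have hodd : e % 2 = 1 := by
            simp only [Cond.Holds, NExp.eval] at hodd
            omega
          refine (ends_mulP hn h₄n (by decide) (by decide) (by decide) (by decide) (by decide)
            (by decide) (by decide) (by decide)).seq fun m₅ f₅ h₅ => ?_
          have e₅ : m₅.num 14 = m.num 14 := (f₅.num 14 (by simp)).trans h₄14
          refine (hcopy ((f₅.num 1 (by simp)).trans h₄n) (by decide) (by decide) (by decide)).imp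
            le_rfl fun m₆ f₆ h₆ => ?_
          rw [e₅] at h₆
          rw [h₄14] at h₅
          rw [h₆, h₅, hodd, pow_one]
        · intro heven
          have heven : e % 2 = 0 := by
            simp only [Cond.Holds, NExp.eval] at heven
            omega
          exact (ends_skip (by simp [heven])).mono (by omega)
      · intro m₅ f₅ h₅
        have e₅ : m₅.num 14 = m.num 14 := (f₅.num 14 (by simp)).trans h₄14
        have n₅ : m₅.num 1 = n := (f₅.num 1 (by simp)).trans h₄n
        have x₅ : m₅.mat n 1 = m₄.mat n 1 := by
          funext l
          rw [Mem.mat, Mem.mat, f₅.farr 1 (by simp)]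
        refine (ends_mulP hn n₅ (by decide) (by decide) (by decide) (by decide) (by decide)
            (by decide) (by decide) (by decide)).seq fun m₆ f₆ h₆ => ?_
        have e₆ : m₆.num 14 = m.num 14 := (f₆.num 14 (by simp)).trans e₅
        have n₆ : m₆.num 1 = n := (f₆.num 1 (by simp)).trans n₅
        refine (hcopy n₆ (by decide) (by decide) (by decide)).seq fun m₇ f₇ h₇ => ?_
        have x₇ : m₇.mat n 1 (m.num 14) = m₄.mat n 1 (m.num 14) ^ 2 := by
          rw [e₆] at h₇
          rw [e₅] at h₆
          rw [h₇, h₆, x₅, pow_two]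
        have y₇ : m₇.mat n 2 (m.num 14) = m₄.mat n 2 (m.num 14) *
            m₄.mat n 1 (m.num 14) ^ (e % 2) := by
          rw [Mem.mat, f₇.farr 2 (by simp), f₆.farr 2 (by simp)]
          exact h₅
        have e₇ : m₇.num 13 = e := by
          rw [f₇.num 13 (by simp), f₆.num 13 (by simp), f₅.num 13 (by simp)]
        refine (ends_setNum ⟨?_, ?_, ?_, ?_⟩).mono (by simp [NExp.cost])
        · have : e / 2 * 2 ≤ e := Nat.div_mul_le_self e 2
          simp only [Mem.setNum, NExp.eval, e₇, if_true]
          refine lt_of_le_of_lt ?_ hlt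
          rw [pow_succ']
          nlinarith [Nat.two_pow_pos k]
        · simpa [Mem.setNum] using (f₇.num 14 (by simp)).trans e₆
        · simpa [Mem.setNum] using (f₇.num 1 (by simp)).trans n₆
        · change m₇.mat n 2 (m.num 14) * m₇.mat n 1 (m.num 14) ^ _ = _
          simp only [Mem.setNum, NExp.eval, e₇, if_true]
          rw [x₇, y₇, ← pow_mul, mul_assoc, ← pow_add, Nat.mod_add_div]
          exact h₄
    · have := Nat.lt_pow_succ_log_self (b := 2) (by norm_num) p
      rw [h₃e]
      simp only [pow_zero, mul_one]
      exact lt_of_le_of_lt (Nat.sub_le _ _) this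
    · rw [h₃2, h₃1, h₃e, ← pow_succ']
      congr 1
      omega
    · simp only [Cond.cost, NExp.cost]
      have := Nat.mul_le_mul_left (Nat.log 2 p + 1) (show 93 * n ^ 3 + 36 * n ^ 2 + 8 + 1 +
        (93 * n ^ 3 + (36 * n ^ 2 + 3)) + (1 + 1 + 1) + 1 ≤ 300 * n ^ 3 by omega)
      omega
    · rintro m₄ - ⟨hb, k, -, -, -, h₄⟩
      have : m₄.num 13 = 0 := by simpa [Cond.Holds, NExp.eval] using hb
      rwa [this, pow_zero, mul_one] at h₄
  · have : n ^ 3 ≤ (Nat.log 2 p + 1) * n ^ 3 := Nat.le_mul_of_pos_left _ (by omega)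
    have e : (Nat.log 2 p + 1) * (300 * n ^ 3) = 300 * ((Nat.log 2 p + 1) * n ^ 3) := by ring
    omega

/-! ### Bases in echelon form -/

/-- A list of vectors under construction: the vectors are `vec 0, …, vec (count - 1)`, and the
vector `vec k` is meant to have its pivot at the position `(row k, col k)`. -/
structure EchelonData (K : Type) where
  count : ℕ
  vec : ℕ → ℕ → ℕ → K
  row : ℕ → ℕ
  col : ℕ → ℕ

namespace EchelonData

variable {K : Type} [Field K] {n : ℕ}

/-- Every vector has the entry `1` at its own pivot, and all later vectors vanish there. -/
def Valid (D : EchelonData K) (n : ℕ) : Prop :=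
  ∀ k < D.count, D.row k < n ∧ D.col k < n ∧ D.vec k (D.row k) (D.col k) = 1 ∧
    ∀ j, k < j → j < D.count → D.vec j (D.row k) (D.col k) = 0

/-- The span of the vectors, regarded as `n × n` matrices. -/
def span (D : EchelonData K) (n : ℕ) : Submodule K (Matrix (Fin n) (Fin n) K) :=
  Submodule.span K ((fun k => block n (D.vec k)) '' Set.Iio D.count)

theorem block_mem_span (D : EchelonData K) {k : ℕ} (hk : k < D.count) :
    block n (D.vec k) ∈ D.span n :=
  Submodule.subset_span ⟨k, hk, rfl⟩

theorem span_eq_span_range (D : EchelonData K) :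
    D.span n = Submodule.span K (Set.range fun k : Fin D.count => block n (D.vec k)) := by
  rw [span]
  congr 1
  ext x
  constructor
  · rintro ⟨k, hk, rfl⟩
    exact ⟨⟨k, hk⟩, rfl⟩
  · rintro ⟨k, rfl⟩
    exact ⟨k, k.2, rfl⟩

theorem Valid.linearIndependent {D : EchelonData K} (h : D.Valid n) :
    LinearIndependent K fun k : Fin D.count => block n (D.vec k) := by
  rw [Fintype.linearIndependent_iff]
  intro g hg k
  -- At the pivot of the vector `k`, the earlier vectors do not contribute by induction.
  induction k using WellFoundedLT.induction with
  | _ k ih =>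
  obtain ⟨hr, hc, h1, h0⟩ := h k k.2
  have := congrFun (congrFun hg ⟨_, hr⟩) ⟨_, hc⟩
  rw [Matrix.sum_apply, Finset.sum_eq_single k] at this
  · simpa [block, h1] using this
  · intro j _ hj
    rcases lt_or_gt_of_ne hj with hj | hj
    · simp [ih j hj]
    · simp [block, h0 j hj j.2]
  · simp

theorem Valid.finrank_span {D : EchelonData K} (h : D.Valid n) :
    Module.finrank K (D.span n) = D.count := by
  rw [span_eq_span_range, finrank_span_eq_card h.linearIndependent, Fintype.card_fin]

theorem Valid.count_le {D : EchelonData K} (h : D.Valid n) : D.count ≤ n ^ 2 := by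
  simpa [Module.finrank_matrix, pow_two] using h.linearIndependent.fintype_card_le_finrank

/-- The data `D'` arises from `D` by appending vectors that enlarge the span by the matrix `v`. -/
structure Extends (D : EchelonData K) (n : ℕ) (v : Matrix (Fin n) (Fin n) K)
    (D' : EchelonData K) : Prop where
  valid : D'.Valid n
  span_eq : D'.span n = D.span n ⊔ Submodule.span K {v}
  count_le : D.count ≤ D'.count
  vec_eq : ∀ k < D.count, D'.vec k = D.vec k

theorem Extends.span_le {D D' : EchelonData K} {v : Matrix (Fin n) (Fin n) K}
    (h : D.Extends n v D') : D.span n ≤ D'.span n :=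
  h.span_eq ▸ le_sup_left

theorem Extends.mem {D D' : EchelonData K} {v : Matrix (Fin n) (Fin n) K}
    (h : D.Extends n v D') : v ∈ D'.span n :=
  h.span_eq ▸ Submodule.mem_sup_right (Submodule.mem_span_singleton_self v)

theorem Extends.span_le_of_mem {D D' : EchelonData K} {v : Matrix (Fin n) (Fin n) K}
    (h : D.Extends n v D') {S : Submodule K (Matrix (Fin n) (Fin n) K)} (hS : D.span n ≤ S)
    (hv : v ∈ S) : D'.span n ≤ S := by
  rw [h.span_eq]
  exact sup_le hS ((Submodule.span_singleton_le_iff_mem _ _).2 hv)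

/-- A reduced nonzero matrix, scaled to have the entry `1` at `(r, c)`, can be appended with the
pivot `(r, c)`. -/
theorem Valid.append {D D' : EchelonData K} (h : D.Valid n) {W : ℕ → ℕ → K} {r c : ℕ}
    (hW : ∀ k < D.count, W (D.row k) (D.col k) = 0) (hr : r < n) (hc : c < n) (hrc : W r c ≠ 0)
    (hcount : D'.count = D.count + 1) (hvec : ∀ k < D.count, D'.vec k = D.vec k)
    (hnew : ∀ i < n, ∀ j < n, D'.vec D.count i j = (W r c)⁻¹ * W i j)
    (hrow : D'.row = fun k => if k = D.count then r else D.row k)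
    (hcol : D'.col = fun k => if k = D.count then c else D.col k) :
    D'.Valid n ∧ D'.span n = D.span n ⊔ Submodule.span K {block n W} := by
  refine ⟨fun k hk => ?_, ?_⟩
  · rcases Nat.lt_succ_iff_lt_or_eq.1 (hcount ▸ hk) with hk | rfl
    · obtain ⟨h1, h2, h3, h4⟩ := h k hk
      simp only [hrow, hcol, if_neg hk.ne, hvec k hk]
      refine ⟨h1, h2, h3, fun j hj hj' => ?_⟩
      rcases Nat.lt_succ_iff_lt_or_eq.1 (hcount ▸ hj') with hj' | rfl
      · rw [hvec j hj', h4 j hj hj']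
      · rw [hnew _ h1 _ h2, hW k hk, mul_zero]
    · simp only [hrow, hcol, if_true]
      exact ⟨hr, hc, by rw [hnew r hr c hc, inv_mul_cancel₀ hrc], fun j hj hj' => by omega⟩
  · have e : block n (D'.vec D.count) = (W r c)⁻¹ • block n W := by
      ext i j
      simp [block, hnew i i.2 j j.2]
    have hI : Set.Iio (D.count + 1) = insert D.count (Set.Iio D.count) := by
      ext k
      simp only [Set.mem_Iio, Set.mem_insert_iff]
      omega
    rw [span, hcount, hI, Set.image_insert_eq, Submodule.span_insert, sup_comm, e,
      Submodule.span_singleton_smul_eq (IsUnit.mk0 _ (inv_ne_zero hrc)), span]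
    congr 2
    exact Set.image_congr fun k hk => by rw [hvec k hk]

end EchelonData

/-- The data number `d` in the memory: the vectors are in the field array `d + 10`, their number in
the variable `x_(d + 20)`, and the pivots in the number arrays `d + 10` and `d + 20`. -/
def Mem.echelon {K : Type} (m : Mem K) (d : ℕ) : EchelonData K :=
  ⟨m.num (d + 20), m.farr (d + 10), m.narr (d + 10), m.narr (d + 20)⟩

theorem Frame.echelon {K : Type} {P : Prog} {m m' : Mem K} (f : Frame P m m') (d : ℕ)
    (h : d + 20 ∉ P.numTargets) (h₁ : d + 10 ∉ P.narrTargets) (h₂ : d + 20 ∉ P.narrTargets)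
    (h₃ : d + 10 ∉ P.farrTargets) : m'.echelon d = m.echelon d := by
  rw [Mem.echelon, Mem.echelon, f.num _ h, f.narr _ h₁, f.narr _ h₂, f.farr _ h₃]

/-- The program that clears the entries of the matrix in the slot `x₁₄` of the array `4` at the
pivots of the echelon data `d`. -/
def reduceP (d : ℕ) : Prog :=
  forP 7 (d + 20) <|
    .seq (.setField 5 (.const 0) (.const 0) (.const 0)
      (.cell 4 (.var 14) (.cell (d + 10) (.var 7)) (.cell (d + 20) (.var 7))))
    (fillP 4 14 (.sub (entry 4 14) (.mul (.cell 5 (.const 0) (.const 0) (.const 0))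
      (entry (d + 10) 7))))

/-- The program that searches a nonzero entry of the matrix in the slot `x₁₄` of the array `4`.  It
sets `x₈` to `1` and `x₉, x₁₀` to the indices of such an entry if there is one, and `x₈` to `0`
otherwise. -/
def searchP : Prog :=
  .seq (.setNum 8 (.const 0)) <| forP 4 1 <| forP 5 1 <|
    .ite (.fieldEq (entry 4 14) .zero) .skip <|
      .seq (.setNum 8 (.const 1)) <| .seq (.setNum 9 (.var 4)) (.setNum 10 (.var 5))

/-- The program that appends the matrix in the slot `x₁₄` of the array `4` to the echelon data `d`,
with the pivot at `(x₉, x₁₀)`. -/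
def appendP (d : ℕ) : Prog :=
  .seq (.setField 5 (.const 0) (.const 0) (.const 0) (.inv (.cell 4 (.var 14) (.var 9) (.var 10)))) <|
  .seq (fillP (d + 10) (d + 20) (.mul (.cell 5 (.const 0) (.const 0) (.const 0)) (entry 4 14))) <|
  .seq (.setNumCell (d + 10) (.var (d + 20)) (.var 9)) <|
  .seq (.setNumCell (d + 20) (.var (d + 20)) (.var 10)) <|
  .setNum (d + 20) (.add (.var (d + 20)) (.const 1))

/-- The program that adds the matrix in the slot `x₁₄` of the array `4` to the span of the echelon
data `d`. -/
def insertP (d : ℕ) : Prog :=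
  .seq (reduceP d) <| .seq searchP <| .ite (.numEq (.var 8) (.const 0)) .skip (appendP d)

@[simp] theorem numTargets_reduceP (d : ℕ) : (reduceP d).numTargets = [7, 4, 5, 5, 4, 7] := rfl
@[simp] theorem narrTargets_reduceP (d : ℕ) : (reduceP d).narrTargets = [] := rfl
@[simp] theorem farrTargets_reduceP (d : ℕ) : (reduceP d).farrTargets = [5, 4] := rfl
@[simp] theorem numTargets_searchP : searchP.numTargets = [8, 4, 5, 8, 9, 10, 5, 4] := rfl
@[simp] theorem narrTargets_searchP : searchP.narrTargets = [] := rfl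
@[simp] theorem farrTargets_searchP : searchP.farrTargets = [] := rfl
@[simp] theorem numTargets_insertP (d : ℕ) : (insertP d).numTargets =
    [7, 4, 5, 5, 4, 7, 8, 4, 5, 8, 9, 10, 5, 4, 4, 5, 5, 4, d + 20] := rfl
@[simp] theorem narrTargets_insertP (d : ℕ) : (insertP d).narrTargets = [d + 10, d + 20] := rfl
@[simp] theorem farrTargets_insertP (d : ℕ) : (insertP d).farrTargets = [5, 4, 5, d + 10] := rfl

section Insert

variable {K : Type} [Field K] {n : ℕ}

theorem ends_reduceP {m : Mem K} {d : ℕ} (hn : 0 < n) (h1 : m.num 1 = n)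
    (hD : (m.echelon d).Valid n) :
    (reduceP d).Ends m (70 * n ^ 4) fun m' =>
      m'.mat n 4 (m.num 14) - m.mat n 4 (m.num 14) ∈ (m.echelon d).span n ∧
      ∀ k < (m.echelon d).count,
        m'.farr 4 (m.num 14) ((m.echelon d).row k) ((m.echelon d).col k) = 0 := by
  set D := m.echelon d with hDdef
  refine (ends_forP (N := D.count) (B := 10 + 46 * n ^ 2) (fun k m' =>
    m'.mat n 4 (m.num 14) - m.mat n 4 (m.num 14) ∈ D.span n ∧
      ∀ k' < k, m'.farr 4 (m.num 14) (D.row k') (D.col k') = 0)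
      rfl (by simp) (by simp) (by simp) (fun _ _ _ h => h) ⟨by simp, by simp⟩ ?_).imp ?_ ?_
  · rintro k m₁ hk h₁7 f₁ ⟨h₁, h₁z⟩
    have e₁ : m₁.num 14 = m.num 14 := f₁.num 14 (by simp)
    have hD₁ : m₁.echelon d = D := f₁.echelon d (by simp) (by simp) (by simp) (by simp)
    obtain ⟨hr, hc, hp, hz⟩ := hD k hk
    have hrow : m₁.narr (d + 10) = D.row := congrArg EchelonData.row hD₁
    have hcol : m₁.narr (d + 20) = D.col := congrArg EchelonData.col hD₁
    have hvec : m₁.farr (d + 10) = D.vec := congrArg EchelonData.vec hD₁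
    set W := m₁.farr 4 (m.num 14) with hW
    refine Prog.Ends.seq (B := 10) (B' := 46 * n ^ 2) (Q := fun m' =>
      m'.farr 5 0 0 0 = W (D.row k) (D.col k) ∧ m'.farr 4 = m₁.farr 4) ?_ ?_
    · refine (ends_setField ⟨?_, ?_⟩).mono (by simp [NExp.cost, FExp.cost])
      · simp [Mem.setField, NExp.eval, FExp.eval, h₁7, e₁, hrow, hcol, hW]
      · funext; simp [Mem.setField]
    rintro m₂ f₂ ⟨h₂5, h₂4⟩
    have e₂ : m₂.num 14 = m.num 14 := (f₂.num 14 (by simp)).trans e₁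
    refine (ends_fillP (n := n) (fun i j => W i j - W (D.row k) (D.col k) * D.vec k i j) hn
      (by rw [f₂.num 1 (by simp), f₁.num 1 (by simp), h1]) (by decide) (by decide) ?_).imp ?_ ?_
    · intro i j m' hi hj h4 h5 hx _ hf hself
      rw [e₂] at hself
      simp only [entry, FExp.eval, NExp.eval, h4, h5, hx 14 (by decide) (by decide), e₂, hself,
        hx 7 (by decide) (by decide), f₂.num 7 (by simp), h₁7, h₂4, ← hW,
        hf 5 _ (Or.inl (by decide)), h₂5, hf (d + 10) _ (Or.inl (by omega)),
        f₂.farr (d + 10) (by simp), hvec]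
    · simp [FExp.cost, NExp.cost]
    · rintro m₃ - ⟨-, h₃, -⟩
      rw [e₂] at h₃
      have h₃' := block_eq_iff.1 h₃
      refine ⟨?_, fun k' hk' => ?_⟩
      · have : m₃.mat n 4 (m.num 14) - m.mat n 4 (m.num 14) =
            (m₁.mat n 4 (m.num 14) - m.mat n 4 (m.num 14)) -
              W (D.row k) (D.col k) • block n (D.vec k) := by
          rw [h₃]
          ext i j
          simp only [block, Mem.mat, Matrix.sub_apply, Matrix.smul_apply, Matrix.of_apply,
            smul_eq_mul, ← hW]
          ring
        rw [this]
        exact sub_mem h₁ (Submodule.smul_mem _ _ (D.block_mem_span hk))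
      · rcases Nat.lt_succ_iff_lt_or_eq.1 hk' with hk' | rfl
        · obtain ⟨hr', hc', -, hz'⟩ := hD k' (hk'.trans hk)
          rw [h₃' _ hr' _ hc', hz' k hk' hk, h₁z k' hk', mul_zero, sub_zero]
        · rw [h₃' _ hr _ hc, hp, mul_one, sub_self]
  · have hc := hD.count_le
    have : n ^ 2 ≤ n ^ 4 := Nat.pow_le_pow_right hn (by norm_num)
    have h1 : 1 ≤ n ^ 4 := Nat.one_le_pow _ _ hn
    have := Nat.mul_le_mul_right (10 + 46 * n ^ 2 + 8) hc
    have e : n ^ 2 * (10 + 46 * n ^ 2 + 8) = 18 * n ^ 2 + 46 * n ^ 4 := by ring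
    omega
  · exact fun m' _ h => h

theorem ends_searchP {m : Mem K} (hn : 0 < n) (h1 : m.num 1 = n) :
    searchP.Ends m (60 * n ^ 2) fun m' =>
      (m'.num 8 = 0 ∧ ∀ i < n, ∀ j < n, m.farr 4 (m.num 14) i j = 0) ∨
      (m'.num 8 = 1 ∧ m'.num 9 < n ∧ m'.num 10 < n ∧
        m.farr 4 (m.num 14) (m'.num 9) (m'.num 10) ≠ 0) := by
  set W := m.farr 4 (m.num 14) with hW
  let I : ℕ → ℕ → Mem K → Prop := fun i j m' =>
    (m'.num 8 = 0 ∧ ∀ x < n, ∀ z < n, x < i ∨ x = i ∧ z < j → W x z = 0) ∨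
      (m'.num 8 = 1 ∧ m'.num 9 < n ∧ m'.num 10 < n ∧ W (m'.num 9) (m'.num 10) ≠ 0)
  refine (Prog.Ends.seq (B := 2) (B' := n * (38 * n ^ 1 + 8) + 6) (Q := I 0 0) (Q' := I n 0)
    ?_ fun m₀ f₀ h₀ => ?_).imp ?_ ?_
  · exact ends_setNum (Or.inl ⟨by simp [Mem.setNum, NExp.eval], by simp⟩)
  · refine ends_forP (N := n) (fun i => I i 0) ((f₀.num 1 (by simp)).trans h1) (by decide) (by simp)
      (by simp) (fun k m' v h => by simpa [I, Mem.setNum] using h) h₀ ?_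
    rintro i m₁ hi h₁4 f₁ h₁
    refine (ends_forP (N := n) (B := 24) (fun j => I i j)
      (by rw [f₁.num 1 (by simp), f₀.num 1 (by simp), h1]) (by decide) (by simp)
      (by simp) (fun k m' v h => by simpa [I, Mem.setNum] using h) h₁ ?_).imp ?_ ?_
    · rintro j m₂ hj h₂5 f₂ h₂
      have hw : FExp.eval m₂ (entry 4 14) = W i j := by
        simp [FExp.eval, NExp.eval, h₂5, f₂.num 4, h₁4, f₂.num 14, f₁.num 14, f₀.num 14, f₂.farr 4,
          f₁.farr 4, f₀.farr 4, hW]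
      refine (ends_ite (B := 6) (fun hb => ?_) fun hb => ?_).mono
        (by simp [Cond.cost, NExp.cost, FExp.cost])
      · refine (ends_skip ?_).mono (by norm_num)
        rcases h₂ with ⟨h8, hz⟩ | h
        · refine Or.inl ⟨h8, fun x hx z hz' hxz => ?_⟩
          by_cases hxz' : x = i ∧ z = j
          · obtain ⟨rfl, rfl⟩ := hxz'
            rw [← hw]
            exact hb
          · exact hz x hx z hz' (by omega)
        · exact Or.inr h
      · refine (Prog.Ends.seq (B := 2) (B' := 4) (ends_setNum (Q := fun m' => m'.num 8 = 1) ?_)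
          fun m₃ f₃ h₃ => Prog.Ends.seq (B := 2) (B' := 2)
            (ends_setNum (Q := fun m' => m'.num 9 = i) ?_)
              fun m₄ f₄ h₄ => ends_setNum ?_).mono le_rfl
        · simp [Mem.setNum, NExp.eval]
        · simp [Mem.setNum, NExp.eval, f₃.num 4, f₂.num 4, h₁4]
        · have e8 : m₄.num 8 = 1 := by rw [f₄.num 8 (by simp), h₃]
          have e5 : m₄.num 5 = j := by rw [f₄.num 5 (by simp), f₃.num 5 (by simp), h₂5]
          refine Or.inr ?_
          have hne : W i j ≠ 0 := by
            rw [← hw]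
            exact hb
          simpa [Mem.setNum, NExp.eval, e8, h₄, e5, hi, hj] using hne
    · have := for_bound (C := 24) 0 hn
      simpa using this
    · rintro m₃ - (⟨h8, hz⟩ | h)
      · exact Or.inl ⟨h8, fun x hx z hz' hxz => hz x hx z hz' (by omega)⟩
      · exact Or.inr h
  · have := for_bound (C := 38) 1 hn
    have h2 : 1 ≤ n ^ 2 := Nat.one_le_pow _ _ hn
    simp only [Nat.reduceAdd] at this
    omega
  · rintro m' - (⟨h8, hz⟩ | h)
    · exact Or.inl ⟨h8, fun x hx z hz' => hz x hx z hz' (Or.inl hx)⟩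
    · exact Or.inr h

theorem ends_insertP {m : Mem K} {d : ℕ} (hn : 0 < n) (h1 : m.num 1 = n)
    (hD : (m.echelon d).Valid n) :
    (insertP d).Ends m (200 * n ^ 4) fun m' =>
      (m.echelon d).Extends n (m.mat n 4 (m.num 14)) (m'.echelon d) := by
  suffices h : (insertP d).Ends m (200 * n ^ 4) fun m' =>
      (m'.echelon d).Valid n ∧
      (m'.echelon d).span n =
        (m.echelon d).span n ⊔ Submodule.span K {m.mat n 4 (m.num 14)} ∧
      (m.echelon d).count ≤ (m'.echelon d).count ∧
      ∀ k < (m.echelon d).count, (m'.echelon d).vec k = (m.echelon d).vec k from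
    h.imp le_rfl fun _ _ ⟨h₁, h₂, h₃, h₄⟩ => ⟨h₁, h₂, h₃, h₄⟩
  have n2 : 1 ≤ n ^ 2 := Nat.one_le_pow _ _ hn
  have n24 : n ^ 2 ≤ n ^ 4 := Nat.pow_le_pow_right hn (by norm_num)
  refine ((ends_reduceP hn h1 hD).seq (B' := 130 * n ^ 4) fun m₁ f₁ ⟨h₁, h₁z⟩ => ?_).mono (by omega)
  have e₁ : m₁.num 14 = m.num 14 := f₁.num 14 (by simp)
  have hD₁ : m₁.echelon d = m.echelon d := f₁.echelon d (by simp) (by simp) (by simp) (by simp)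
  -- Subtracting a vector of the span does not change what is added to the span.
  have hspan : (m.echelon d).span n ⊔ Submodule.span K {m₁.mat n 4 (m.num 14)} =
      (m.echelon d).span n ⊔ Submodule.span K {m.mat n 4 (m.num 14)} := by
    refine le_antisymm (sup_le le_sup_left ?_) (sup_le le_sup_left ?_) <;>
      rw [Submodule.span_singleton_le_iff_mem]
    · have := add_mem (Submodule.mem_sup_left (T := Submodule.span K {m.mat n 4 (m.num 14)}) h₁)
        (Submodule.mem_sup_right (Submodule.mem_span_singleton_self (m.mat n 4 (m.num 14))))
      rwa [sub_add_cancel] at this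
    · have := sub_mem (Submodule.mem_sup_right
        (Submodule.mem_span_singleton_self (m₁.mat n 4 (m.num 14))))
        (Submodule.mem_sup_left (T := Submodule.span K {m₁.mat n 4 (m.num 14)}) h₁)
      rwa [sub_sub_cancel] at this
  rw [← hspan]
  set D := m.echelon d
  refine ((ends_searchP hn ((f₁.num 1 (by simp)).trans h1)).seq (B' := 70 * n ^ 2)
    fun m₂ f₂ h₂ => ?_).mono (by omega)
  have e₂ : m₂.num 14 = m.num 14 := (f₂.num 14 (by simp)).trans e₁
  have hD₂ : m₂.echelon d = D :=
    (f₂.echelon d (by simp) (by simp) (by simp) (by simp)).trans hD₁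
  rw [e₁] at h₂
  refine (ends_ite (B := 64 * n ^ 2) (fun hb => ?_) fun hb => ?_).mono
    (by simp only [Cond.cost, NExp.cost]; omega)
  · refine (ends_skip ?_).mono (by omega)
    rw [hD₂]
    refine ⟨hD, ?_, le_rfl, fun _ _ => rfl⟩
    rcases h₂ with ⟨-, hz⟩ | ⟨h8, -⟩
    · have : m₁.mat n 4 (m.num 14) = 0 := by
        ext i j
        exact hz i i.2 j j.2
      simp [this]
    · simp [Cond.Holds, NExp.eval, h8] at hb
  · rcases h₂ with ⟨h8, -⟩ | ⟨-, hr, hc, hrc⟩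
    · simp [Cond.Holds, NExp.eval, h8] at hb
    set W := m₁.farr 4 (m.num 14)
    have hW₂ : m₂.farr 4 (m.num 14) = W := by rw [f₂.farr 4 (by simp)]
    set r := m₂.num 9 with hr9
    set c := m₂.num 10 with hc10
    refine (Prog.Ends.seq (B := 9) (B' := 55 * n ^ 2) (Q := fun m' =>
      m'.farr 5 0 0 0 = (W r c)⁻¹ ∧ m'.farr 4 = m₂.farr 4) ?_ ?_).mono (by omega)
    · refine (ends_setField ⟨?_, ?_⟩).mono (by simp [NExp.cost, FExp.cost])
      · simp [Mem.setField, NExp.eval, FExp.eval, e₂, hW₂, hr9, hc10]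
      · funext; simp [Mem.setField]
    rintro m₃ f₃ ⟨h₃5, h₃4⟩
    have hD₃ : m₃.echelon d = D :=
      (f₃.echelon d (by simp) (by simp) (by simp) (by simp)).trans hD₂
    have hc₃ : m₃.num (d + 20) = D.count := congrArg EchelonData.count hD₃
    refine (Prog.Ends.seq (B := 41 * n ^ 2) (B' := 12) ((ends_fillP (n := n)
      (fun i j => (W r c)⁻¹ * W i j) hn ?_ (by omega) (by omega) ?_).mono
        (by simp [FExp.cost, NExp.cost])) ?_).mono (by omega)
    · rw [f₃.num 1 (by simp), f₂.num 1 (by simp), f₁.num 1 (by simp), h1]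
    · intro i j m' hi hj h4 h5 hx _ hf _
      simp only [entry, FExp.eval, NExp.eval, h4, h5, hx 14 (by decide) (by decide),
        f₃.num 14 (by simp), e₂, hf 5 _ (Or.inl (by omega)), hf 4 _ (Or.inl (by omega)), h₃5, h₃4,
        hW₂]
    rintro m₄ f₄ ⟨-, h₄, h₄f⟩
    rw [hc₃] at h₄
    have h₄f' := block_eq_iff.1 h₄
    have hc₄ : m₄.num (d + 20) = D.count := (f₄.num (d + 20) (by simp)).trans hc₃
    have hr₄ : m₄.num 9 = r := by rw [f₄.num 9 (by simp), f₃.num 9 (by simp)]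
    have hq₄ : m₄.num 10 = c := by rw [f₄.num 10 (by simp), f₃.num 10 (by simp)]
    have hrow₄ : m₄.narr (d + 10) = D.row :=
      (f₄.narr _ (by simp)).trans (congrArg EchelonData.row hD₃)
    have hcol₄ : m₄.narr (d + 20) = D.col :=
      (f₄.narr _ (by simp)).trans (congrArg EchelonData.col hD₃)
    have hvec₃ : m₃.farr (d + 10) = D.vec := congrArg EchelonData.vec hD₃
    refine ⟨_, _, .seq (.setNumCell _ _ _ _) (.seq (.setNumCell _ _ _ _) (.setNum _ _ _)),
      by simp [NExp.cost], ?_⟩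
    have hvec : ∀ k < D.count, m₄.farr (d + 10) k = D.vec k := fun k hk => by
      rw [h₄f _ _ (Or.inr (by omega)), hvec₃]
    refine and_assoc.1 ⟨hD.append (W := W) (r := r) (c := c) h₁z hr hc hrc ?_ hvec h₄f' ?_ ?_, ?_,
      hvec⟩
    · simp [Mem.echelon, Mem.setNum, Mem.setNumCell, NExp.eval, hc₄]
    · funext k
      simp [Mem.echelon, Mem.setNum, Mem.setNumCell, NExp.eval, hc₄, hr₄, hrow₄]
    · funext k
      simp [Mem.echelon, Mem.setNum, Mem.setNumCell, NExp.eval, hc₄, hq₄, hcol₄]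
    · simp [Mem.echelon, Mem.setNum, Mem.setNumCell, NExp.eval, hc₄]

end Insert
/-! ### The decision procedure -/

/-- For the generator `A` with index `x₁₂` and the basis vector `E` with index `x₁₁`, the program
that adds `A * E` to the span of the echelon data `0` and `A * E - E * A` to that of the echelon
data `1`. -/
def closeP : Prog :=
  .seq (mulP 0 12 10 11 1) <| .seq (mulP 10 11 0 12 2) <| .seq (subP 1 14 2 14 4) <|
    .seq (insertP 1) <| .seq (copyP 1 14 4) (insertP 0)

/-- For the basis vector `E` with index `x₁₁`, the program that adds `E ^ p` to the span of the
echelon data `2` and `E ^ p - E` to that of the echelon data `3`. -/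
def frobeniusP : Prog :=
  .seq (powP 10 11) <| .seq (copyP 2 14 4) <| .seq (insertP 2) <|
    .seq (subP 2 14 10 11 4) (insertP 3)

/-- The program that computes a basis of the algebra generated by the input matrices, as the echelon
data `0`, and the span of commutators, as the echelon data `1`. -/
def basisP : Prog :=
  .seq (copyP 0 14 4) <| .seq (insertP 0) <| .seq (.setNum 11 (.const 0)) <|
    .loop (.numLt (.var 11) (.var 20))
      (.seq (forP 12 2 closeP) (.setNum 11 (.add (.var 11) (.const 1))))

/-- The final test: commutators vanish, the Frobenius map has full rank, its difference with the
identity has corank `1`, and the dimension is `x₃`. -/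
def verdictP : Prog :=
  .ite (.conj (.conj (.numEq (.var 21) (.const 0)) (.numEq (.var 22) (.var 20)))
      (.conj (.numEq (.add (.var 23) (.const 1)) (.var 20)) (.numEq (.var 20) (.var 3))))
    (.setNum 0 (.const 1)) (.setNum 0 (.const 0))

/-- The program that decides whether the input matrices generate a field of degree `x₃`. -/
def fieldTestP : Prog :=
  .seq basisP <| .seq (forP 11 20 frobeniusP) verdictP

section

variable {K : Type} [Field K] {n : ℕ}

theorem ends_closeP {m : Mem K} (hn : 0 < n) (h1 : m.num 1 = n)
    (h₀ : (m.echelon 0).Valid n) (h₁ : (m.echelon 1).Valid n) :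
    closeP.Ends m (663 * n ^ 4) fun m' =>
      (m.echelon 0).Extends n (m.mat n 0 (m.num 12) * m.mat n 10 (m.num 11)) (m'.echelon 0) ∧
      (m.echelon 1).Extends n (m.mat n 0 (m.num 12) * m.mat n 10 (m.num 11) -
        m.mat n 10 (m.num 11) * m.mat n 0 (m.num 12)) (m'.echelon 1) := by
  have n24 : n ^ 2 ≤ n ^ 4 := Nat.pow_le_pow_right hn (by norm_num)
  have n34 : n ^ 3 ≤ n ^ 4 := Nat.pow_le_pow_right hn (by norm_num)
  set A := m.mat n 0 (m.num 12) with hA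
  set E := m.mat n 10 (m.num 11) with hE
  refine ((ends_mulP hn h1 (by decide) (by decide) (by decide) (by decide) (by decide) (by decide)
    (by decide) (by decide)).seq (B' := 93 * n ^ 3 + (41 * n ^ 2 + (200 * n ^ 4 + (36 * n ^ 2 +
      200 * n ^ 4)))) fun m₁ f₁ g₁ => ?_).mono (by omega)
  have n₁ : m₁.num 1 = n := (f₁.num 1 (by simp)).trans h1
  refine (ends_mulP hn n₁ (by decide) (by decide) (by decide) (by decide) (by decide) (by decide)
    (by decide) (by decide)).seq fun m₂ f₂ g₂ => ?_
  have n₂ : m₂.num 1 = n := (f₂.num 1 (by simp)).trans n₁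
  refine (ends_subP hn n₂ (by decide) (by decide) (by decide) (by decide) (by decide)
    (by decide)).seq fun m₃ f₃ g₃ => ?_
  have n₃ : m₃.num 1 = n := (f₃.num 1 (by simp)).trans n₂
  have e₁ : m₁.num 14 = m.num 14 := f₁.num 14 (by simp)
  have e₂ : m₂.num 14 = m.num 14 := (f₂.num 14 (by simp)).trans e₁
  have e₃ : m₃.num 14 = m.num 14 := (f₃.num 14 (by simp)).trans e₂
  have hX₂ : m₂.mat n 1 (m.num 14) = A * E := by
    rw [Mem.mat, f₂.farr 1 (by simp)]
    exact g₁
  have hX₃ : m₃.mat n 1 (m.num 14) = A * E := by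
    rw [Mem.mat, f₃.farr 1 (by simp)]
    exact hX₂
  have hY₂ : m₂.mat n 2 (m.num 14) = E * A := by
    rw [← e₁, g₂, Mem.mat, Mem.mat, f₁.farr 10 (by simp), f₁.farr 0 (by simp), f₁.num 11 (by simp),
      f₁.num 12 (by simp)]
    rfl
  have hW₃ : m₃.mat n 4 (m.num 14) = A * E - E * A := by rw [← hX₂, ← hY₂, ← e₂, g₃]
  have d₃ : ∀ d ≤ 1, m₃.echelon d = m.echelon d := fun d hd => by
    rw [f₃.echelon d, f₂.echelon d, f₁.echelon d] <;> simp
  refine (ends_insertP hn n₃ (d₃ 1 le_rfl ▸ h₁)).seq fun m₄ f₄ g₄ => ?_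
  rw [e₃, d₃ 1 le_rfl, hW₃] at g₄
  have n₄ : m₄.num 1 = n := (f₄.num 1 (by simp)).trans n₃
  have e₄ : m₄.num 14 = m.num 14 := (f₄.num 14 (by simp)).trans e₃
  refine (ends_copyP hn n₄ (by decide) (by decide) (by decide)).seq fun m₅ f₅ g₅ => ?_
  have n₅ : m₅.num 1 = n := (f₅.num 1 (by simp)).trans n₄
  have e₅ : m₅.num 14 = m.num 14 := (f₅.num 14 (by simp)).trans e₄
  have hW₅ : m₅.mat n 4 (m.num 14) = A * E := by
    rw [← e₄, g₅, Mem.mat, f₄.farr 1 (by simp), e₄]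
    exact hX₃
  have d₅ : m₅.echelon 0 = m.echelon 0 := by
    rw [f₅.echelon 0, f₄.echelon 0, d₃ 0] <;> simp
  refine (ends_insertP hn n₅ (d₅ ▸ h₀)).imp le_rfl fun m₆ f₆ g₆ => ⟨?_, ?_⟩
  · rwa [e₅, d₅, hW₅] at g₆
  · rw [f₆.echelon 1, f₅.echelon 1]
    · exact g₄
    all_goals simp

theorem ends_frobeniusP {m : Mem K} {p : ℕ} (hn : 0 < n) (hp : 0 < p) (h0 : m.num 0 = p)
    (h1 : m.num 1 = n) (h₂ : (m.echelon 2).Valid n) (h₃ : (m.echelon 3).Valid n) :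
    frobeniusP.Ends m (900 * ((Nat.log 2 p + 1) * n ^ 4)) fun m' =>
      (m.echelon 2).Extends n (m.mat n 10 (m.num 11) ^ p) (m'.echelon 2) ∧
      (m.echelon 3).Extends n (m.mat n 10 (m.num 11) ^ p - m.mat n 10 (m.num 11))
        (m'.echelon 3) := by
  have n24 : n ^ 2 ≤ n ^ 4 := Nat.pow_le_pow_right hn (by norm_num)
  have n34 : n ^ 3 ≤ n ^ 4 := Nat.pow_le_pow_right hn (by norm_num)
  set E := m.mat n 10 (m.num 11) with hE
  refine ((ends_powP hn h1 h0 hp (by decide) (by decide) (by decide) (by decide)).seq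
    (B' := 36 * n ^ 2 + (200 * n ^ 4 + (41 * n ^ 2 + 200 * n ^ 4))) fun m₁ f₁ g₁ => ?_).mono ?_
  · have n₁ : m₁.num 1 = n := (f₁.num 1 (by simp)).trans h1
    have e₁ : m₁.num 14 = m.num 14 := f₁.num 14 (by simp)
    refine (ends_copyP hn n₁ (by decide) (by decide) (by decide)).seq fun m₂ f₂ g₂ => ?_
    have n₂ : m₂.num 1 = n := (f₂.num 1 (by simp)).trans n₁
    have e₂ : m₂.num 14 = m.num 14 := (f₂.num 14 (by simp)).trans e₁
    have d₂ : ∀ d, m₂.echelon d = m.echelon d := fun d => by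
      rw [f₂.echelon d, f₁.echelon d] <;> simp
    have hW₂ : m₂.mat n 4 (m.num 14) = E ^ p := by rw [← e₁, g₂, e₁, g₁]
    refine (ends_insertP hn n₂ (d₂ 2 ▸ h₂)).seq fun m₃ f₃ g₃ => ?_
    have n₃ : m₃.num 1 = n := (f₃.num 1 (by simp)).trans n₂
    have e₃ : m₃.num 14 = m.num 14 := (f₃.num 14 (by simp)).trans e₂
    rw [e₂, d₂, hW₂] at g₃
    refine (ends_subP hn n₃ (by decide) (by decide) (by decide) (by decide) (by decide)
      (by decide)).seq fun m₄ f₄ g₄ => ?_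
    have n₄ : m₄.num 1 = n := (f₄.num 1 (by simp)).trans n₃
    have e₄ : m₄.num 14 = m.num 14 := (f₄.num 14 (by simp)).trans e₃
    have d₄ : m₄.echelon 3 = m.echelon 3 := by
      rw [f₄.echelon 3, f₃.echelon 3, d₂] <;> simp
    have hW₄ : m₄.mat n 4 (m.num 14) = E ^ p - E := by
      rw [← e₃, g₄, Mem.mat, Mem.mat, f₃.farr 2 (by simp), f₂.farr 2 (by simp), f₃.farr 10 (by simp),
        f₂.farr 10 (by simp), f₁.farr 10 (by simp), f₃.num 11 (by simp), f₂.num 11 (by simp),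
        f₁.num 11 (by simp), e₃, ← g₁]
      rfl
    refine (ends_insertP hn n₄ (d₄ ▸ h₃)).imp le_rfl fun m₅ f₅ g₅ => ⟨?_, ?_⟩
    · rw [f₅.echelon 2, f₄.echelon 2]
      · exact g₃
      all_goals simp
    · rwa [e₄, d₄, hW₄] at g₅
  · have h4 : n ^ 4 ≤ (Nat.log 2 p + 1) * n ^ 4 := Nat.le_mul_of_pos_left _ (by omega)
    have h3 := Nat.mul_le_mul_left (Nat.log 2 p + 1) n34
    omega

/-- Every product of a generator with a vector of the echelon data `0` is inserted into the span of
these data, while their number grows, but never beyond `n ^ 2`. -/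
theorem ends_basisP {m : Mem K} {t : ℕ} (hn : 0 < n) (ht : 0 < t) (h1 : m.num 1 = n)
    (h2 : m.num 2 = t) (h14 : m.num 14 = 0)
    (h₀ : (m.echelon 0).count = 0) (h₁ : (m.echelon 1).count = 0)
    (R : Subalgebra K (Matrix (Fin n) (Fin n) K)) (hR : ∀ l < t, m.mat n 0 l ∈ R) :
    basisP.Ends m (1000 * (t * n ^ 6)) fun m' =>
      (m'.echelon 0).Valid n ∧ (m'.echelon 1).Valid n ∧
      (m'.echelon 0).span n ≤ Subalgebra.toSubmodule R ∧
      ((∀ x ∈ R, ∀ y ∈ R, x * y = y * x) → (m'.echelon 1).span n = ⊥) ∧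
      m.mat n 0 0 ∈ (m'.echelon 0).span n ∧
      ∀ k < (m'.echelon 0).count, ∀ l < t,
        m.mat n 0 l * block n ((m'.echelon 0).vec k) ∈ (m'.echelon 0).span n ∧
        m.mat n 0 l * block n ((m'.echelon 0).vec k) - block n ((m'.echelon 0).vec k) * m.mat n 0 l ∈
          (m'.echelon 1).span n := by
  -- The part of the invariant that does not depend on the position in the loops.
  let J : EchelonData K → EchelonData K → Prop := fun D₀ D₁ =>
    D₀.Valid n ∧ D₁.Valid n ∧ D₀.span n ≤ Subalgebra.toSubmodule R ∧
      ((∀ x ∈ R, ∀ y ∈ R, x * y = y * x) → D₁.span n = ⊥)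
  have hvalid : ∀ D : EchelonData K, D.count = 0 → D.Valid n := fun D hD k hk => by omega
  have hspan : ∀ D : EchelonData K, D.count = 0 → D.span n = ⊥ := fun D hD => by
    simp [EchelonData.span, hD]
  refine ((ends_copyP hn h1 (by decide) (by decide) (by decide)).seq
    (B' := 200 * n ^ 4 + (2 + (n ^ 2 * (t * (663 * n ^ 4 + 8) + 6 + 4 + 3 + 1) + 3 + 1)))
    fun m₁ f₁ g₁ => ?_).mono ?_
  · have n₁ : m₁.num 1 = n := (f₁.num 1 (by simp)).trans h1
    have e₁ : m₁.num 14 = 0 := (f₁.num 14 (by simp)).trans h14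
    have d₁ : ∀ d, m₁.echelon d = m.echelon d := fun d => f₁.echelon d (by simp) (by simp) (by simp)
      (by simp)
    refine (ends_insertP hn n₁ (d₁ 0 ▸ hvalid _ h₀)).seq fun m₂ f₂ g₂ => ?_
    rw [d₁, e₁] at g₂
    rw [h14] at g₁
    rw [g₁] at g₂
    have d₂ : m₂.echelon 1 = m.echelon 1 := by
      rw [f₂.echelon 1, d₁] <;> simp
    have J₂ : J (m₂.echelon 0) (m₂.echelon 1) := by
      rw [d₂]
      refine ⟨g₂.valid, hvalid _ h₁, g₂.span_le_of_mem ?_ (hR 0 ht), fun _ => hspan _ h₁⟩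
      rw [hspan _ h₀]
      exact bot_le
    refine Prog.Ends.seq (B := 2) (Q := fun m' => m'.num 11 = 0 ∧ m'.num 1 = n ∧ m'.num 2 = t ∧
      m'.farr 0 = m.farr 0 ∧ m'.echelon 0 = m₂.echelon 0 ∧ m'.echelon 1 = m₂.echelon 1)
      (ends_setNum ?_) ?_
    · simp [Mem.setNum, NExp.eval, f₂.num 1, f₁.num 1, h1, f₂.num 2, f₁.num 2, h2, f₂.farr 0,
        f₁.farr 0, Mem.echelon]
    rintro m₃ - ⟨h₃11, n₃, t₃, a₃, d₃, d₃'⟩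
    refine (ends_loop (N := n ^ 2) (B := t * (663 * n ^ 4 + 8) + 6 + 4) (fun k m' =>
      m'.num 11 = k ∧ k ≤ (m'.echelon 0).count ∧ J (m'.echelon 0) (m'.echelon 1) ∧
        m.mat n 0 0 ∈ (m'.echelon 0).span n ∧
        ∀ k' < k, ∀ l < t,
          m.mat n 0 l * block n ((m'.echelon 0).vec k') ∈ (m'.echelon 0).span n ∧
          m.mat n 0 l * block n ((m'.echelon 0).vec k') -
            block n ((m'.echelon 0).vec k') * m.mat n 0 l ∈ (m'.echelon 1).span n)
      ?_ ⟨h₃11, by omega, by rw [d₃, d₃']; exact J₂, by rw [d₃]; exact g₂.mem, by simp⟩).imp le_rfl ?_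
    · rintro k m₄ f₄ ⟨k₄, hk₄, J₄, hA₄, hcl₄⟩ hb
      have hk : k < (m₄.echelon 0).count := show k < m₄.num 20 by
        simpa [Cond.Holds, NExp.eval, k₄] using hb
      refine ⟨hk.trans_le J₄.1.count_le, ?_⟩
      have a₄ : m₄.farr 0 = m.farr 0 := by rw [f₄.farr 0 (by simp [closeP]), a₃]
      have hinner := ends_forP (P := closeP) (x := 12) (y := 2) (m := m₄) (N := t)
        (B := 663 * n ^ 4) (fun l m' =>
        J (m'.echelon 0) (m'.echelon 1) ∧ (m₄.echelon 0).count ≤ (m'.echelon 0).count ∧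
          (∀ k' < (m₄.echelon 0).count, (m'.echelon 0).vec k' = (m₄.echelon 0).vec k') ∧
          (m₄.echelon 0).span n ≤ (m'.echelon 0).span n ∧
          (m₄.echelon 1).span n ≤ (m'.echelon 1).span n ∧
          ∀ l' < l, m.mat n 0 l' * block n ((m₄.echelon 0).vec k) ∈ (m'.echelon 0).span n ∧
            m.mat n 0 l' * block n ((m₄.echelon 0).vec k) -
              block n ((m₄.echelon 0).vec k) * m.mat n 0 l' ∈ (m'.echelon 1).span n)
        ((f₄.num 2 (by simp [closeP])).trans t₃) (by decide) (by simp [closeP]) (by simp [closeP])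
        (fun l m' v h => by simpa [Mem.echelon, Mem.setNum] using h)
        ⟨J₄, le_rfl, fun _ _ => rfl, le_rfl, le_rfl, by simp⟩ ?_
      · refine hinner.seq fun m₅ f₅ ⟨J₅, hc₅, hv₅, hs₅, hs₅', hcl₅⟩ => ?_
        have k₅ : m₅.num 11 = k := (f₅.num 11 (by simp [closeP])).trans k₄
        refine (ends_setNum ?_).mono (show _ ≤ 4 by simp [NExp.cost])
        have e : ∀ d v, (m₅.setNum 11 v).echelon d = m₅.echelon d := by
          simp [Mem.echelon, Mem.setNum]
        simp only [e]
        refine ⟨by simp [Mem.setNum, NExp.eval, k₅], by omega, J₅, hs₅ hA₄, fun k' hk' l hl => ?_⟩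
        rw [hv₅ k' (by omega)]
        rcases Nat.lt_succ_iff_lt_or_eq.1 hk' with hk' | rfl
        · exact ⟨hs₅ (hcl₄ k' hk' l hl).1, hs₅' (hcl₄ k' hk' l hl).2⟩
        · exact hcl₅ l hl
      · rintro l m₅ hl l₅ f₅ ⟨J₅, hc₅, hv₅, hs₅, hs₅', hcl₅⟩
        have n₅ : m₅.num 1 = n := by
          rw [f₅.num 1 (by simp [closeP]), f₄.num 1 (by simp [closeP]), n₃]
        refine (ends_closeP hn n₅ J₅.1 J₅.2.1).imp le_rfl fun m₆ _ ⟨x₀, x₁⟩ => ?_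
        have hA : m₅.mat n 0 (m₅.num 12) = m.mat n 0 l := by
          rw [Mem.mat, f₅.farr 0 (by simp [closeP]), a₄, l₅, Mem.mat]
        have hE : m₅.mat n 10 (m₅.num 11) = block n ((m₄.echelon 0).vec k) := by
          rw [f₅.num 11 (by simp [closeP]), k₄, ← hv₅ k hk]
          rfl
        rw [hA, hE] at x₀ x₁
        have hER : block n ((m₄.echelon 0).vec k) ∈ R := J₄.2.2.1 ((m₄.echelon 0).block_mem_span hk)
        refine ⟨⟨x₀.valid, x₁.valid, x₀.span_le_of_mem J₅.2.2.1 (R.mul_mem (hR l hl) hER), ?_⟩,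
          hc₅.trans x₀.count_le, fun k' hk' => ?_, hs₅.trans x₀.span_le, hs₅'.trans x₁.span_le,
          fun l' hl' => ?_⟩
        · intro hcomm
          refine le_bot_iff.1 (x₁.span_le_of_mem (J₅.2.2.2 hcomm).le ?_)
          rw [hcomm _ (hR l hl) _ hER, sub_self]
          exact zero_mem _
        · rw [x₀.vec_eq k' (hk'.trans_le hc₅), hv₅ k' hk']
        · rcases Nat.lt_succ_iff_lt_or_eq.1 hl' with hl' | rfl
          · exact ⟨x₀.span_le (hcl₅ l' hl').1, x₁.span_le (hcl₅ l' hl').2⟩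
          · exact ⟨x₀.mem, x₁.mem⟩
    · rintro m₄ - ⟨hb, k, hk, hkc, ⟨v₀, v₁, hle, hcomm⟩, hA, hcl⟩
      have : ¬ k < (m₄.echelon 0).count := show ¬ k < m₄.num 20 by
        simpa [Cond.Holds, NExp.eval, hk] using hb
      exact ⟨v₀, v₁, hle, hcomm, hA, fun k' hk' l hl => hcl k' (by omega) l hl⟩
  · have n26 : n ^ 2 ≤ t * n ^ 6 :=
      (Nat.pow_le_pow_right hn (by norm_num)).trans (Nat.le_mul_of_pos_left _ ht)
    have n46 : n ^ 4 ≤ t * n ^ 6 :=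
      (Nat.pow_le_pow_right hn (by norm_num)).trans (Nat.le_mul_of_pos_left _ ht)
    have n06 : 1 ≤ t * n ^ 6 := Nat.mul_pos ht (by positivity)
    have nt : t * n ^ 2 ≤ t * n ^ 6 := Nat.mul_le_mul_left t (Nat.pow_le_pow_right hn (by norm_num))
    have e : n ^ 2 * (t * (663 * n ^ 4 + 8) + 6 + 4 + 3 + 1) =
      663 * (t * n ^ 6) + 8 * (t * n ^ 2) + 14 * n ^ 2 := by ring
    omega

theorem ends_forP_frobeniusP {m : Mem K} {p : ℕ} (hn : 0 < n) (hp : 0 < p) (h0 : m.num 0 = p)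
    (h1 : m.num 1 = n) (hD : (m.echelon 0).Valid n) (h₂ : (m.echelon 2).count = 0)
    (h₃ : (m.echelon 3).count = 0) :
    (forP 11 20 frobeniusP).Ends m (914 * ((Nat.log 2 p + 1) * n ^ 6)) fun m' =>
      (m'.echelon 2).Valid n ∧ (m'.echelon 3).Valid n ∧
      (m'.echelon 2).span n = Submodule.span K ((fun k => block n ((m.echelon 0).vec k) ^ p) ''
        Set.Iio (m.echelon 0).count) ∧
      (m'.echelon 3).span n = Submodule.span K ((fun k => block n ((m.echelon 0).vec k) ^ p -
        block n ((m.echelon 0).vec k)) '' Set.Iio (m.echelon 0).count) := by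
  set D := m.echelon 0 with hD0
  have hI : ∀ k : ℕ, Set.Iio (k + 1) = insert k (Set.Iio k) := fun k => by
    ext j
    simp only [Set.mem_Iio, Set.mem_insert_iff]
    omega
  have hsucc : ∀ (g : ℕ → Matrix (Fin n) (Fin n) K) (k : ℕ), Submodule.span K (g '' Set.Iio (k + 1)) =
      Submodule.span K (g '' Set.Iio k) ⊔ Submodule.span K {g k} := fun g k => by
    rw [hI, Set.image_insert_eq, Submodule.span_insert, sup_comm]
  refine (ends_forP (N := D.count) (B := 900 * ((Nat.log 2 p + 1) * n ^ 4)) (fun k m' =>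
      (m'.echelon 2).Valid n ∧ (m'.echelon 3).Valid n ∧
      (m'.echelon 2).span n = Submodule.span K ((fun k => block n (D.vec k) ^ p) '' Set.Iio k) ∧
      (m'.echelon 3).span n = Submodule.span K ((fun k => block n (D.vec k) ^ p -
        block n (D.vec k)) '' Set.Iio k)) rfl (by decide) (by simp [frobeniusP])
      (by simp [frobeniusP]) (fun l m' v h => by simpa [Mem.echelon, Mem.setNum] using h)
      ⟨fun k hk => by omega, fun k hk => by omega, by simp [EchelonData.span, h₂],
        by simp [EchelonData.span, h₃]⟩ ?_).imp ?_ fun _ _ h => h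
  · rintro k m₁ hk k₁ f₁ ⟨v₂, v₃, s₂, s₃⟩
    have hE : m₁.mat n 10 (m₁.num 11) = block n (D.vec k) := by
      rw [k₁, Mem.mat, f₁.farr 10 (by simp [frobeniusP])]
      rfl
    refine (ends_frobeniusP hn hp ((f₁.num 0 (by simp [frobeniusP])).trans h0)
      ((f₁.num 1 (by simp [frobeniusP])).trans h1) v₂ v₃).imp le_rfl fun m₂ _ ⟨x₂, x₃⟩ => ?_
    rw [hE] at x₂ x₃
    exact ⟨x₂.valid, x₃.valid, by rw [x₂.span_eq, s₂, hsucc], by rw [x₃.span_eq, s₃, hsucc]⟩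
  · have hc := hD.count_le
    have := Nat.mul_le_mul_right (900 * ((Nat.log 2 p + 1) * n ^ 4) + 8) hc
    have e : n ^ 2 * (900 * ((Nat.log 2 p + 1) * n ^ 4) + 8) =
      900 * ((Nat.log 2 p + 1) * n ^ 6) + 8 * n ^ 2 := by ring
    have n26 : n ^ 2 ≤ (Nat.log 2 p + 1) * n ^ 6 :=
      (Nat.pow_le_pow_right hn (by norm_num)).trans (Nat.le_mul_of_pos_left _ (by omega))
    have n2 : 1 ≤ n ^ 2 := Nat.one_le_pow _ _ hn
    omega

end
end FieldRAM

/-! ### Algebras over `𝔽_p` that are fields -/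

section
variable {p : ℕ} [Fact p.Prime] {R : Type*} [CommRing R] [Algebra (ZMod p) R]

/-- A nontrivial finite commutative `𝔽_p`-algebra is a field if and only if the Frobenius map is
injective and fixes only the line `𝔽_p`; here both conditions are stated as ranks. -/
theorem isField_iff_finrank_frobenius [Nontrivial R] [Module.Finite (ZMod p) R]
    (φ : R →ₗ[ZMod p] R) (hφ : ∀ x, φ x = x ^ p) :
    IsField R ↔ Module.finrank (ZMod p) (LinearMap.range φ) = Module.finrank (ZMod p) R ∧
      Module.finrank (ZMod p) (LinearMap.range (φ - LinearMap.id)) + 1 =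
        Module.finrank (ZMod p) R := by
  have hp : p.Prime := Fact.out
  have : Finite R := Module.finite_of_finite (ZMod p)
  have h₁ := LinearMap.finrank_range_add_finrank_ker φ
  have h₂ := LinearMap.finrank_range_add_finrank_ker (φ - LinearMap.id)
  have hmem : ∀ x, x ∈ LinearMap.ker (φ - LinearMap.id) ↔ x ^ p = x := fun x => by
    simp [hφ, sub_eq_zero]
  have hspan : Submodule.span (ZMod p) {(1 : R)} ≤ LinearMap.ker (φ - LinearMap.id) := by
    rw [Submodule.span_singleton_le_iff_mem, hmem, one_pow]
  constructor
  · intro hR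
    let _ := hR.toField
    have hker : LinearMap.ker φ = ⊥ := by
      rw [LinearMap.ker_eq_bot']
      intro x hx
      rw [hφ] at hx
      exact eq_zero_of_pow_eq_zero hx
    -- The fixed points are roots of `X ^ p - X`, and the elements of `𝔽_p` are all of these.
    have hker' : LinearMap.ker (φ - LinearMap.id) = Submodule.span (ZMod p) {(1 : R)} := by
      refine le_antisymm (fun x hx => ?_) hspan
      rw [hmem] at hx
      classical
      have hinj : Function.Injective (algebraMap (ZMod p) R) := (algebraMap (ZMod p) R).injective
      have hne : (Polynomial.X ^ p - Polynomial.X : Polynomial R) ≠ 0 :=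
        FiniteField.X_pow_card_sub_X_ne_zero R hp.one_lt
      have hsub : Finset.univ.image (algebraMap (ZMod p) R) ⊆
          (Polynomial.X ^ p - Polynomial.X : Polynomial R).roots.toFinset := by
        intro y hy
        obtain ⟨a, -, rfl⟩ := Finset.mem_image.1 hy
        rw [Multiset.mem_toFinset, Polynomial.mem_roots hne]
        simp [← map_pow, ZMod.pow_card]
      have hcard : (Polynomial.X ^ p - Polynomial.X : Polynomial R).roots.toFinset.card ≤
          (Finset.univ.image (algebraMap (ZMod p) R)).card := by
        rw [Finset.card_image_of_injective _ hinj, Finset.card_univ, ZMod.card]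
        refine (Multiset.toFinset_card_le _).trans ((Polynomial.card_roots' _).trans ?_)
        rw [FiniteField.X_pow_card_sub_X_natDegree_eq R hp.one_lt]
      have hx' : x ∈ (Polynomial.X ^ p - Polynomial.X : Polynomial R).roots.toFinset := by
        rw [Multiset.mem_toFinset, Polynomial.mem_roots hne]
        simp [hx]
      rw [← Finset.eq_of_subset_of_card_le hsub hcard] at hx'
      obtain ⟨a, -, rfl⟩ := Finset.mem_image.1 hx'
      rw [Algebra.algebraMap_eq_smul_one]
      exact Submodule.smul_mem _ _ (Submodule.mem_span_singleton_self 1)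
    rw [hker, finrank_bot] at h₁
    rw [hker', finrank_span_singleton one_ne_zero] at h₂
    exact ⟨h₁, h₂⟩
  · rintro ⟨hr₁, hr₂⟩
    have hinj : Function.Injective φ := by
      rw [← LinearMap.ker_eq_bot, ← Submodule.finrank_eq_zero (R := ZMod p)]
      omega
    have hker' : LinearMap.ker (φ - LinearMap.id) = Submodule.span (ZMod p) {(1 : R)} := by
      refine (Submodule.eq_of_le_of_finrank_eq hspan ?_).symm
      rw [finrank_span_singleton one_ne_zero]
      omega
    refine ⟨exists_pair_ne R, mul_comm, fun {a} ha => ?_⟩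
    -- Some iterate of the Frobenius map is the identity, so `a ^ q = a` for some `q ≥ 2`.
    obtain ⟨r, hr⟩ : ∃ r, a ^ (r + 2) = a := by
      let σ : Equiv.Perm R := Equiv.ofBijective φ (Finite.injective_iff_bijective.1 hinj)
      have hpow : ∀ k x, (σ ^ k) x = x ^ p ^ k := by
        intro k
        induction k with
        | zero => simp
        | succ k ih =>
          intro x
          rw [pow_succ', Equiv.Perm.mul_apply, ih, pow_succ, pow_mul]
          exact hφ _
      have h1 := hpow (orderOf σ) a
      rw [pow_orderOf_eq_one, Equiv.Perm.one_apply] at h1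
      have h2 : 1 < p ^ orderOf σ := Nat.one_lt_pow (orderOf_pos σ).ne' hp.one_lt
      exact ⟨p ^ orderOf σ - 2, by rw [Nat.sub_add_cancel h2]; exact h1.symm⟩
    -- Hence `a ^ (q - 1)` is idempotent, so it is a fixed point of the Frobenius map.
    have hidem : IsIdempotentElem (a ^ (r + 1)) := by
      rw [IsIdempotentElem, ← pow_add, show r + 1 + (r + 1) = r + (r + 2) by ring, pow_add, hr,
        ← pow_succ]
    have hfix : a ^ (r + 1) ∈ LinearMap.ker (φ - LinearMap.id) := by
      rw [hmem, hidem.pow_eq hp.ne_zero]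
    rw [hker', Submodule.mem_span_singleton] at hfix
    obtain ⟨c, hc⟩ := hfix
    have hc0 : c ≠ 0 := by
      rintro rfl
      rw [zero_smul] at hc
      rw [pow_succ, ← hc, zero_mul] at hr
      exact ha hr.symm
    refine ⟨c⁻¹ • a ^ r, ?_⟩
    rw [mul_smul_comm, ← pow_succ', ← hc, smul_smul, inv_mul_cancel₀ hc0, one_smul]

end

section
variable {p : ℕ} [Fact p.Prime] {V : Type*} [Ring V] [Algebra (ZMod p) V]

/-- The criterion `isField_iff_finrank_frobenius` in terms of the powers of a basis, computed in a
ring `V` that contains the algebra. -/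
theorem isField_iff_of_injective {R : Type*} [CommRing R] [Algebra (ZMod p) R] [Nontrivial R]
    [Module.Finite (ZMod p) R] (ι : R →ₐ[ZMod p] V) (hι : Function.Injective ι) {c : ℕ} (b : ℕ → V)
    (hb : Submodule.span (ZMod p) (b '' Set.Iio c) = LinearMap.range ι.toLinearMap)
    (hc : Module.finrank (ZMod p) R = c) :
    IsField R ↔ Module.finrank (ZMod p)
        (Submodule.span (ZMod p) ((fun k => b k ^ p) '' Set.Iio c)) = c ∧
      Module.finrank (ZMod p)
        (Submodule.span (ZMod p) ((fun k => b k ^ p - b k) '' Set.Iio c)) + 1 = c := by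
  let φ : R →ₗ[ZMod p] R := (FiniteField.frobeniusAlgHom (ZMod p) R).toLinearMap
  have hφ : ∀ x, φ x = x ^ p := fun x => by simp [φ, ZMod.card]
  have hbR : ∀ k ∈ Set.Iio c, ∃ x, ι x = b k := fun k hk => by
    have : b k ∈ LinearMap.range ι.toLinearMap := by
      rw [← hb]
      exact Submodule.subset_span ⟨k, hk, rfl⟩
    exact this
  have htop : Submodule.span (ZMod p) {x : R | ι x ∈ b '' Set.Iio c} = ⊤ := by
    refine Submodule.map_injective_of_injective (f := ι.toLinearMap) hι ?_
    rw [Submodule.map_span, Submodule.map_top, ← hb]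
    congr 1
    ext x
    constructor
    · rintro ⟨y, hy, rfl⟩
      exact hy
    · rintro ⟨k, hk, rfl⟩
      obtain ⟨y, hy⟩ := hbR k hk
      exact ⟨y, ⟨k, hk, hy.symm⟩, hy⟩
  have key : ∀ ψ : R →ₗ[ZMod p] R, ∀ g : V → V, (∀ x : R, ι (ψ x) = g (ι x)) →
      Module.finrank (ZMod p)
        (Submodule.span (ZMod p) ((fun k => g (b k)) '' Set.Iio c)) =
      Module.finrank (ZMod p) (LinearMap.range ψ) := by
    intro ψ g hg
    have himg : ι.toLinearMap '' (ψ '' {x : R | ι x ∈ b '' Set.Iio c}) =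
        (fun k => g (b k)) '' Set.Iio c := by
      ext x
      constructor
      · rintro ⟨_, ⟨y, ⟨k, hk, hy⟩, rfl⟩, rfl⟩
        exact ⟨k, hk, by simp [hg, ← hy]⟩
      · rintro ⟨k, hk, rfl⟩
        obtain ⟨y, hy⟩ := hbR k hk
        exact ⟨ψ y, ⟨y, ⟨k, hk, hy.symm⟩, rfl⟩, by simp [hg, hy]⟩
    rw [← himg, ← Submodule.map_span, ← Submodule.map_span, htop, ← LinearMap.range_eq_map]
    exact (LinearEquiv.finrank_eq (Submodule.equivMapOfInjective ι.toLinearMap hι _)).symm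
  rw [key φ (· ^ p) (fun x => by rw [hφ, map_pow]),
    key (φ - LinearMap.id) (fun x => x ^ p - x) (fun x => by simp [hφ])]
  have := isField_iff_finrank_frobenius φ hφ
  rwa [hc] at this

/-- The criterion for subalgebras: commutativity, and two ranks computed from a basis. -/
theorem isField_subalgebra_iff [Nontrivial V] [Module.Finite (ZMod p) V]
    (R : Subalgebra (ZMod p) V) {c : ℕ} (b : ℕ → V)
    (hR : Submodule.span (ZMod p) (b '' Set.Iio c) = Subalgebra.toSubmodule R)
    (hc : Module.finrank (ZMod p) R = c) :
    IsField R ↔ (∀ x ∈ R, ∀ y ∈ R, x * y = y * x) ∧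
      Module.finrank (ZMod p)
        (Submodule.span (ZMod p) ((fun k => b k ^ p) '' Set.Iio c)) = c ∧
      Module.finrank (ZMod p)
        (Submodule.span (ZMod p) ((fun k => b k ^ p - b k) '' Set.Iio c)) + 1 = c := by
  by_cases hcomm : ∀ x ∈ R, ∀ y ∈ R, x * y = y * x
  · rw [and_iff_right hcomm]
    let _ : CommRing R :=
      { R.toRing with mul_comm := fun x y => Subtype.ext (hcomm x x.2 y y.2) }
    refine isField_iff_of_injective R.val Subtype.val_injective b (hR.trans ?_) hc
    ext x
    simp
  · refine iff_of_false (fun h => hcomm fun x hx y hy => ?_) fun h => hcomm h.1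
    exact congrArg Subtype.val (h.mul_comm ⟨x, hx⟩ ⟨y, hy⟩)
end

section
variable {F V : Type*} [Field F] [Ring V] [Algebra F V]

/-- A subspace that is stable under left multiplication by generators of an algebra and contains a
generator of finite multiplicative order contains the algebra. -/
theorem adjoin_le_of_mul_mem {X : Set V} {S : Submodule F V} (hS : ∀ x ∈ X, ∀ y ∈ S, x * y ∈ S)
    {x : V} (hx : x ∈ X) (hxS : x ∈ S) (hfin : IsOfFinOrder x) :
    Subalgebra.toSubmodule (Algebra.adjoin F X) ≤ S := by
  have hpow : ∀ k, x ^ (k + 1) ∈ S := by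
    intro k
    induction k with
    | zero => simpa using hxS
    | succ k ih =>
      rw [pow_succ']
      exact hS x hx _ ih
  have hone : (1 : V) ∈ S := by
    have := hpow (orderOf x - 1)
    rwa [Nat.sub_add_cancel hfin.orderOf_pos, pow_orderOf_eq_one] at this
  intro y hy
  rw [Subalgebra.mem_toSubmodule] at hy
  have : ∀ z ∈ S, y * z ∈ S := by
    induction hy using Algebra.adjoin_induction with
    | mem y hy => exact hS y hy
    | algebraMap r =>
      intro z hz
      rw [← Algebra.smul_def]
      exact S.smul_mem r hz
    | add y y' _ _ h h' =>
      intro z hz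
      rw [add_mul]
      exact S.add_mem (h z hz) (h' z hz)
    | mul y y' _ _ h h' =>
      intro z hz
      rw [mul_assoc]
      exact h _ (h' z hz)
  simpa using this 1 hone

theorem adjoin_comm_of_span {X : Set V} {B : Set V}
    (hB : Submodule.span F B = Subalgebra.toSubmodule (Algebra.adjoin F X))
    (h : ∀ x ∈ X, ∀ y ∈ B, x * y = y * x) :
    ∀ x ∈ Algebra.adjoin F X, ∀ y ∈ Algebra.adjoin F X, x * y = y * x := by
  intro x hx y hy
  rw [← Subalgebra.mem_toSubmodule, ← hB] at hy
  have hXy : ∀ x ∈ X, Commute x y := by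
    intro x hx
    induction hy using Submodule.span_induction with
    | mem y hy => exact h x hx y hy
    | zero => exact Commute.zero_right x
    | add y y' _ _ h h' => exact h.add_right h'
    | smul r y _ h => exact h.smul_right r
  change Commute x y
  induction hx using Algebra.adjoin_induction with
  | mem x hx => exact hXy x hx
  | algebraMap r => exact Algebra.commutes r y
  | add x x' _ _ h h' => exact h.add_left h'
  | mul x x' _ _ h h' => exact h.mul_left h'
end

/-! ### Correctness and running time of the decision procedure -/

namespace FieldRAM

theorem ends_verdictP {K : Type} [Field K] (m : Mem K) :
    verdictP.Ends m 30 fun m' => m'.answer =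
      if (m.echelon 1).count = 0 ∧ (m.echelon 2).count = (m.echelon 0).count ∧
        (m.echelon 3).count + 1 = (m.echelon 0).count ∧ (m.echelon 0).count = m.num 3
      then 1 else 0 := by
  refine (ends_ite (B := 2) (fun h => ends_setNum ?_) (fun h => ends_setNum ?_)).mono
    (by simp [Cond.cost, NExp.cost])
  · rw [if_pos]
    · rfl
    · obtain ⟨⟨h₁, h₂⟩, h₃, h₄⟩ := h
      exact ⟨h₁, h₂, h₃, h₄⟩
  · rw [if_neg]
    · rfl
    · rintro ⟨h₁, h₂, h₃, h₄⟩
      exact h ⟨⟨h₁, h₂⟩, h₃, h₄⟩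

/-- The final test is correct: the hypotheses describe what the two loops compute.  The data `D₀`
span the algebra because their span contains the invertible matrix `A 0`, some power of which is the
identity, and is stable under left multiplication by the generators. -/
theorem isFieldOfDegree_iff {p n t s : ℕ} [Fact p.Prime] (hn : 0 < n) (ht : 0 < t)
    (A : Fin t → GL (Fin n) (ZMod p)) (D₀ D₁ D₂ D₃ : EchelonData (ZMod p)) (h₀ : D₀.Valid n)
    (h₁ : D₁.Valid n) (h₂ : D₂.Valid n) (h₃ : D₃.Valid n)
    (hle : D₀.span n ≤ Subalgebra.toSubmodule (matrixAlgebra A))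
    (hcomm : (∀ x ∈ matrixAlgebra A, ∀ y ∈ matrixAlgebra A, x * y = y * x) → D₁.span n = ⊥)
    (hA : (A ⟨0, ht⟩ : Matrix (Fin n) (Fin n) (ZMod p)) ∈ D₀.span n)
    (hmul : ∀ k < D₀.count, ∀ l, (A l : Matrix (Fin n) (Fin n) (ZMod p)) * block n (D₀.vec k) ∈
      D₀.span n)
    (hsub : ∀ k < D₀.count, ∀ l, (A l : Matrix (Fin n) (Fin n) (ZMod p)) * block n (D₀.vec k) -
      block n (D₀.vec k) * A l ∈ D₁.span n)
    (hs₂ : D₂.span n = Submodule.span (ZMod p)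
      ((fun k => block n (D₀.vec k) ^ p) '' Set.Iio D₀.count))
    (hs₃ : D₃.span n = Submodule.span (ZMod p)
      ((fun k => block n (D₀.vec k) ^ p - block n (D₀.vec k)) '' Set.Iio D₀.count)) :
    IsFieldOfDegree A s ↔
      D₁.count = 0 ∧ D₂.count = D₀.count ∧ D₃.count + 1 = D₀.count ∧ D₀.count = s := by
  have : Nonempty (Fin n) := ⟨⟨0, hn⟩⟩
  have hspan : D₀.span n = Subalgebra.toSubmodule (matrixAlgebra A) := by
    refine le_antisymm hle (adjoin_le_of_mul_mem ?_ (Set.mem_range_self ⟨0, ht⟩) hA ?_)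
    · rintro _ ⟨l, rfl⟩ y hy
      induction hy using Submodule.span_induction with
      | mem y hy =>
        obtain ⟨k, hk, rfl⟩ := hy
        exact hmul k hk l
      | zero => simp
      | add y z _ _ hy hz =>
        rw [mul_add]
        exact add_mem hy hz
      | smul r y _ hy =>
        rw [mul_smul_comm]
        exact Submodule.smul_mem _ r hy
    · have := isOfFinOrder_of_finite (A ⟨0, ht⟩)
      exact MonoidHom.isOfFinOrder (Units.coeHom (Matrix (Fin n) (Fin n) (ZMod p))) this
  have hrank : Module.finrank (ZMod p) (matrixAlgebra A) = D₀.count := by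
    rw [← h₀.finrank_span, hspan]
    rfl
  have hcomm' : (∀ x ∈ matrixAlgebra A, ∀ y ∈ matrixAlgebra A, x * y = y * x) ↔ D₁.count = 0 := by
    rw [← h₁.finrank_span, Submodule.finrank_eq_zero]
    refine ⟨hcomm, fun h => adjoin_comm_of_span hspan ?_⟩
    rintro _ ⟨l, rfl⟩ _ ⟨k, hk, rfl⟩
    have := hsub k hk l
    rw [h, Submodule.mem_bot, sub_eq_zero] at this
    exact this
  rw [IsFieldOfDegree, isField_subalgebra_iff _ _ hspan hrank, hcomm', ← hs₂, ← hs₃,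
    h₂.finrank_span, h₃.finrank_span, hrank]
  tauto

/-- The number of binary digits of `p ≥ 2` is `O(log p)`. -/
theorem natLog_add_one_le {p : ℕ} (hp : 2 ≤ p) :
    ((Nat.log 2 p + 1 : ℕ) : ℝ) ≤ 4 * Real.log p := by
  have h1 : 1 ≤ Nat.log 2 p := Nat.log_pos (by norm_num) hp
  have h2 : (Nat.log 2 p : ℝ) * Real.log 2 ≤ Real.log p := by
    rw [← Real.log_pow]
    refine Real.log_le_log (by positivity) ?_
    exact_mod_cast Nat.pow_log_le_self 2 (by omega)
  have h3 : (1 : ℝ) ≤ Nat.log 2 p := by exact_mod_cast h1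
  have h4 := Real.log_two_gt_d9
  push_cast
  nlinarith

open scoped Classical in
theorem ends_fieldTestP {p n t s : ℕ} [Fact p.Prime] (hn : 0 < n) (ht : 0 < t)
    (A : Fin t → GL (Fin n) (ZMod p)) :
    fieldTestP.Ends (input p n t s A) (2000 * (t * n ^ 6 * (Nat.log 2 p + 1)))
      fun m' => m'.answer = if IsFieldOfDegree A s then 1 else 0 := by
  have hp : p.Prime := Fact.out
  set m := input p n t s A with hm
  have hin : ∀ l (hl : l < t), m.mat n 0 l = A ⟨l, hl⟩ := fun l hl => by
    ext i j
    simp [hm, Mem.mat, block, input, hl]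
  have hD : ∀ d, (m.echelon d).count = 0 := fun d => by
    simp [hm, Mem.echelon, input]
  refine ((ends_basisP hn ht rfl rfl rfl (hD 0) (hD 1) (matrixAlgebra A)
    fun l hl => ?_).seq (B' := 914 * ((Nat.log 2 p + 1) * n ^ 6) + 30)
    fun m₁ f₁ ⟨v₀, v₁, hle, hcomm, hA, hcl⟩ => ?_).mono ?_
  · rw [hin l hl]
    exact Algebra.subset_adjoin ⟨_, rfl⟩
  · have d₂ : m₁.echelon 2 = m.echelon 2 := by
      rw [f₁.echelon 2] <;> simp [basisP, closeP]
    have d₃ : m₁.echelon 3 = m.echelon 3 := by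
      rw [f₁.echelon 3] <;> simp [basisP, closeP]
    refine (ends_forP_frobeniusP hn hp.pos (f₁.num 0 (by simp [basisP, closeP]))
      (f₁.num 1 (by simp [basisP, closeP])) v₀ (by rw [d₂, hD])
      (by rw [d₃, hD])).seq fun m₂ f₂ ⟨v₂, v₃, s₂, s₃⟩ => ?_
    refine (ends_verdictP m₂).imp le_rfl fun m₃ _ h₃ => ?_
    have d₀ : m₂.echelon 0 = m₁.echelon 0 := by
      rw [f₂.echelon 0] <;> simp [frobeniusP]
    have d₁ : m₂.echelon 1 = m₁.echelon 1 := by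
      rw [f₂.echelon 1] <;> simp [frobeniusP]
    have hs : m₂.num 3 = s := by
      rw [f₂.num 3 (by simp [frobeniusP]), f₁.num 3 (by simp [basisP, closeP])]
      rfl
    rw [h₃, d₀, d₁, hs]
    rw [hin 0 ht] at hA
    refine if_congr (isFieldOfDegree_iff hn ht A _ _ _ _ v₀ v₁ v₂ v₃ hle hcomm hA
      (fun k hk l => ?_) (fun k hk l => ?_) s₂ s₃).symm rfl rfl
    · have := (hcl k hk l l.2).1
      rwa [hin l l.2] at this
    · have := (hcl k hk l l.2).2
      rwa [hin l l.2] at this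
  · have h1 : t * n ^ 6 ≤ t * n ^ 6 * (Nat.log 2 p + 1) := Nat.le_mul_of_pos_right _ (by omega)
    have h2 : (Nat.log 2 p + 1) * n ^ 6 ≤ t * n ^ 6 * (Nat.log 2 p + 1) := by
      rw [mul_comm]
      exact Nat.mul_le_mul_right _ (Nat.le_mul_of_pos_left _ ht)
    have h3 : 0 < t * n ^ 6 := by positivity
    omega

end FieldRAM

/-- One deterministic program, and one constant `C`, serve all `p`, `n`, `t`, `s` and all input
matrices.  On every input the program halts after at most `C * (t * n ^ 6 * log p)` steps (the
operations in `𝔽_p` are among the steps counted) with the correct answer. -/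
theorem theorem3p1 :
    ∃ (P : FieldRAM.Prog) (C : ℝ),
      ∀ (p n t s : ℕ) [Fact p.Prime], 0 < n → 0 < t → 0 < s →
        ∀ A : Fin t → GL (Fin n) (ZMod p),
          ∃ (m : FieldRAM.Mem (ZMod p)) (T : ℕ),
            FieldRAM.Run P (FieldRAM.input p n t s A) m T ∧
            (T : ℝ) ≤ C * ((t : ℝ) * (n : ℝ) ^ 6 * Real.log (p : ℝ)) ∧
            (IsFieldOfDegree A s → m.answer = 1) ∧
            (¬ IsFieldOfDegree A s → m.answer = 0) := by
  refine ⟨FieldRAM.fieldTestP, 8000, fun p n t s _ hn ht _ A => ?_⟩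
  obtain ⟨m, T, hrun, hT, hans⟩ := FieldRAM.ends_fieldTestP (s := s) hn ht A
  refine ⟨m, T, hrun, ?_, fun h => by rw [hans, if_pos h], fun h => by rw [hans, if_neg h]⟩
  have hT' : (T : ℝ) ≤ 2000 * ((t : ℝ) * (n : ℝ) ^ 6 * ((Nat.log 2 p + 1 : ℕ) : ℝ)) := by
    exact_mod_cast hT
  have hlog := FieldRAM.natLog_add_one_le (Fact.out : p.Prime).two_le
  calc (T : ℝ) ≤ _ := hT'
    _ ≤ 2000 * ((t : ℝ) * (n : ℝ) ^ 6 * (4 * Real.log p)) := by gcongr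
    _ = _ := by ring
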